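/- **Conventions.** A simplicial space is a functor $\Delta^{op}\to\mathbf{sSet}$, a bisimplicial space a functor $X:\Delta^{op}\times\Delta^{op}\to\mathbf{sSet}$; write $X_n=X_{n,\bullet}$. For a simplicial set $K$ let $X_K$ be the simplicial space with $((X_K)_{j})_m=\mathrm{Hom}_{\mathbf{sSet}}(K,(X_{\bullet,j})_m)$, so that $X_{\Delta[n]}\cong X_n$; a map $f:K\to L$ induces $f^*:X_L\to X_K$. Let $g_n:Sp(n)\hookrightarrow\Delta[n]$ be the spine, so that $X_{Sp(n)}\cong X_1\times_{X_0}\cdots\times_{X_0}X_1$ for $n\ge1$ and $X_{Sp(0)}\cong X_0$. A *$2$-fold Segal space* is a Reedy fibrant bisimplicial space $X$ such that the Segal maps of $X_{\bullet,m}$ and of $X_{m,\bullet}$ are levelwise weak equivalences for all $m$ and such that $X_{0,\bullet}$ is essentially constant, i.e. the map from the constant simplicial space on $X_{0,0}$ to $X_{0,\bullet}$ is a weak equivalence in the model structure for Segal spaces. A *choice of horizontal compositions* is a family of maps $\mu_n:X_{Sp(n)}\to X_n$, $n\ge0$, with $g_n^*\mu_n=\mathrm{id}$ (so $\mu_0$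 and $\mu_1$ are the canonical isomorphisms). For a simplicial space $A$ over $X_0\times X_0$ and $x,y\in(X_{0,0})_0$ let $A^{x,y}$ be the fibre over $(x,y)$, and $X(x,y)=(X_1)^{x,y}$. **Simplicial composition diagrams.** For cospans $Sp(k_i)\xrightarrow{\iota_i}K_i\xleftarrow{\tau_i}\Delta[1]$ ($1\le i\le n$, $n\geq 1$) and $Sp(n)\xrightarrow{\iota_0}K_0\xleftarrow{\tau_0}\Delta[1]$, the *grafting* $$K=(K_1\sqcup_{\Delta[0]}\cdots\sqcup_{\Delta[0]}K_n)\sqcup_{Sp(n)}K_0$$ is formed by gluing the last spine vertex of $K_i$ to the first spine vertex of $K_{i+1}$ and then taking the pushout of $\tau_1\sqcup\cdots\sqcup\tau_n:Sp(n)\to K_1\sqcup_{\Delta[0]}\cdots\sqcup_{\Delta[0]}K_n$ and $\iota_0$. With $r=k_1+\cdots+k_n$ it is a cospan $Sp(r)\xrightarrow{\iota}K\xleftarrow{\tau}\Delta[1]$, where $\iota$ is induced by $\iota_1\sqcup\cdots\sqcup\iota_n$ and $\tau$ by $\tau_0$. *Simplicial composition diagrams* (of arity $n$) are the cospans $Sp(n)\to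 K\leftarrow\Delta[1]$ obtained inductively, up to isomorphism, as (1) $Sp(n)\xrightarrow{g_n}\Delta[n]\xleftarrow{\langle0,n\rangle}\Delta[1]$ with $n\ge0$, or (2) the grafting of simplicial composition diagrams $K_1,\dots,K_d$, $d>1$, onto $K_0=\Delta[d]$ as in (1). The *induced composition* $\mu_K:X_{Sp(n)}\to X_K$, a section of $\iota^*$, is $\mu_n$ in case (1), and in case (2), where $X_K\cong(X_{K_1}\times_{X_0}\cdots\times_{X_0}X_{K_d})\times_{X_{Sp(d)}}X_d$, it is the map with components $\mu_{K_1}\times_{X_0}\cdots\times_{X_0}\mu_{K_d}$ and $\mu_d\circ(\tau_1^*\times_{X_0}\cdots\times_{X_0}\tau_d^*)\circ(\mu_{K_1}\times_{X_0}\cdots\times_{X_0}\mu_{K_d})$. For $x_0,\dots,x_n\in(X_{0,0})_0$ let $$\circ_K^{x_0,\dots,x_n}:\ \prod_{i=1}^nX(x_{i-1},x_i)\hookrightarrow X_{Sp(n)}^{x_0,x_n}\xrightarrow{\mu_K}X_K^{x_0,x_n}\xrightarrow{\tau^*}X(x_0,x_n).$$ **Theorem.** Let $X$ be a $2$-fold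 Segal space with a choice of horizontal compositions, and let $K_0,K_1,\dots,K_n$ be simplicial composition diagrams, where $K_i$ has arity $k_i$ for $1\le i\le n$ and $K_0$ has arity $n\ge1$. Let $r=k_1+\cdots+k_n$, and let $((x^1_0,\dots,x^1_{k_1}),\dots,(x^n_0,\dots,x^n_{k_n}))$ be a nested list of elements of $(X_{0,0})_0$ with $x^i_{k_i}=x^{i+1}_0$ for $i<n$, with flattened version $(x_0,\dots,x_r)$, in which the $x^i_{k_i}$ with $i<n$ are removed. Then the grafting $K=(K_1\sqcup_{\Delta[0]}\cdots\sqcup_{\Delta[0]}K_n)\sqcup_{Sp(n)}K_0$ is a simplicial composition diagram, and, for the map $\circ_K$ formed from any inductive construction of $K$ as in (1) and (2), $$\circ_K^{x_0,\dots,x_r}=\circ_{K_0}^{x^1_0,x^2_0,\dots,x^n_0,x^n_{k_n}}\circ\left(\circ_{K_1}^{x^1_0,\dots,x^1_{k_1}}\times\cdots\times\circ_{K_n}^{x^n_0,\dots,x^n_{k_n}}\right)$$ under the identification $\prod_{l=1}^rX(x_{l-1},x_l)\cong\prod_{i=1}^n\prod_{j=1}^{k_i}X(x^i_{j-1},x^i_j)$.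 -/

import Mathlib

open CategoryTheory Limits Opposite

universe u

namespace GraftedComp

section Spaces

open Simplicial MonoidalCategory HomotopicalAlgebra

/-! ### Simplicial spaces and the spaces `X_K` -/

/-- Simplicial spaces, i.e. simplicial objects in simplicial sets. For `A : SimplicialSpace`,
the set `(A_j)_m` is `(A.obj (op ⦋j⦌)).obj (op ⦋m⦌)`. -/
abbrev SimplicialSpace : Type (u + 1) := SimplexCategoryᵒᵖ ⥤ SSet.{u}

/-- Bisimplicial spaces, i.e. simplicial objects in simplicial spaces. The simplicial space `X_n`
is `X.obj (op ⦋n⦌)`, and `X_{n,m}` is `(X.obj (op ⦋n⦌)).obj (op ⦋m⦌)`. -/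
abbrev BisimplicialSpace : Type (u + 1) := SimplexCategoryᵒᵖ ⥤ SimplicialSpace.{u}

/-- The simplicial set `A_K` of maps from the levelwise discrete simplicial space on `K` to the
simplicial space `A`: its `m`-simplices are the maps of simplicial sets `K ⟶ A_{•,m}`. -/
def power (K : SSet.{u}) : SimplicialSpace.{u} ⥤ SSet.{u} :=
  flipFunctor _ _ _ ⋙ (Functor.whiskeringRight _ _ _).obj (coyoneda.obj (op K))

/-- The restriction `A_L ⟶ A_K` along `f : K ⟶ L`, natural in `A`. -/
def powerMap {K L : SSet.{u}} (f : K ⟶ L) : power L ⟶ power K :=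
  Functor.whiskerLeft _ ((Functor.whiskeringRight _ _ _).map (coyoneda.map f.op))

/-- The Yoneda isomorphism between `A_{Δ[n]}` and `A_n`. -/
def powerSimplexIso (n : ℕ) :
    power.{u} Δ[n] ≅ (evaluation SimplexCategoryᵒᵖ SSet.{u}).obj (op ⦋n⦌) :=
  NatIso.ofComponents (fun A => NatIso.ofComponents
      (fun m => (SSet.yonedaEquiv (X := A.flip.obj m) (n := ⦋n⦌)).toIso)
      (fun _ => rfl)) (fun _ => rfl)

/-- The simplicial set `X_{•,j,m}`. -/
abbrev column (X : BisimplicialSpace.{u}) (j m : SimplexCategoryᵒᵖ) : SSet.{u} :=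
  (X.flip.obj j).flip.obj m

/-- The simplicial space `X_K` of maps from the levelwise discrete bisimplicial space on `K` (in the
first simplicial direction) to `X`: the elements of `(X_K)_{j,m}` are the maps of simplicial sets
`K ⟶ X_{•,j,m}`. -/
def mapSpace (X : BisimplicialSpace.{u}) (K : SSet.{u}) : SimplicialSpace.{u} :=
  X.flip ⋙ power K

/-- The restriction `f^* : X_L ⟶ X_K` along `f : K ⟶ L`. -/
def restrict (X : BisimplicialSpace.{u}) {K L : SSet.{u}} (f : K ⟶ L) :
    mapSpace X L ⟶ mapSpace X K :=
  Functor.whiskerLeft X.flip (powerMap f)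

/-- The Yoneda isomorphism between `X_{Δ[n]}` and `X_n`. -/
def mapSpaceSimplexIso (X : BisimplicialSpace.{u}) (n : ℕ) :
    mapSpace X Δ[n] ≅ X.obj (op ⦋n⦌) :=
  Functor.isoWhiskerLeft X.flip (powerSimplexIso n)

@[simp]
lemma restrict_id (X : BisimplicialSpace.{u}) (K : SSet.{u}) : restrict X (𝟙 K) = 𝟙 _ := rfl

lemma restrict_comp (X : BisimplicialSpace.{u}) {K L M : SSet.{u}} (f : K ⟶ L) (g : L ⟶ M) :
    restrict X (f ≫ g) = restrict X g ≫ restrict X f := rfl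

/-! ### Spines -/

/-- The spine `Sp(n)` of `Δ[n]`: the simplices all of whose vertices lie in `{i, i + 1}` for
some `i`, i.e. the union of the edges `i → i + 1` (and the single vertex if `n = 0`). -/
def spine (n : ℕ) : (Δ[n] : SSet.{u}).Subcomplex where
  obj _ := {s | ∀ i j, ((SSet.stdSimplex.asOrderHom s j : Fin (n + 1)) : ℕ) ≤
    (SSet.stdSimplex.asOrderHom s i : Fin (n + 1)) + 1}
  map f _ hs i j := hs (f.unop.toOrderHom i) (f.unop.toOrderHom j)

abbrev Sp (n : ℕ) : SSet.{u} := (spine.{u} n).toSSet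

/-- The inclusion `Sp(k) ⟶ Sp(r)` of the part of the spine between the vertices `a` and `a + k`. -/
def spineSub {r : ℕ} (a k : ℕ) (h : a + k ≤ r) : Sp.{u} k ⟶ Sp.{u} r :=
  SSet.Subcomplex.lift ((spine k).ι ≫ SSet.stdSimplex.map (SimplexCategory.subinterval a k h)) (by
    rintro m _ ⟨s, rfl⟩
    intro i j
    have h1 := Nat.add_le_add_right (s.2 i j) a
    rw [Nat.add_right_comm] at h1
    exact h1)

/-- The `i`-th vertex of the spine. -/
def spineVertex {n : ℕ} (i : Fin (n + 1)) : Δ[0] ⟶ Sp.{u} n :=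
  SSet.Subcomplex.lift (SSet.stdSimplex.map (SimplexCategory.const ⦋0⦌ ⦋n⦌ i)) (by
    rintro m _ ⟨s, rfl⟩
    intro _ _
    exact Nat.le_succ i.1)

/-- The `i`-th edge of the spine. -/
def spineEdge {n : ℕ} (i : Fin n) : Δ[1] ⟶ Sp.{u} n :=
  SSet.Subcomplex.lift (SSet.stdSimplex.map (SimplexCategory.mkOfSucc i)) (by
    rintro m _ ⟨s, rfl⟩
    intro a b
    have key : ∀ c : Fin 2, (i : ℕ) ≤ ((SimplexCategory.mkOfSucc i).toOrderHom c).1 ∧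
        ((SimplexCategory.mkOfSucc i).toOrderHom c).1 ≤ i + 1 := by
      intro c
      fin_cases c
      · exact ⟨le_rfl, Nat.le_succ _⟩
      · exact ⟨Nat.le_succ _, le_rfl⟩
    exact (key _).2.trans (Nat.succ_le_succ (key _).1))

/-- For a map `f : [m] → [n]` and `a`, the map `[m] → [1]` sending `i` to `0` if `f i ≤ a` and to `1`
otherwise. -/
def cut {m : SimplexCategory} {n : ℕ} (f : m ⟶ ⦋n⦌) (a : ℕ) : m ⟶ ⦋1⦌ :=
  SimplexCategory.Hom.mk
    { toFun := fun i => if (f.toOrderHom i).1 ≤ a then (0 : Fin 2) else 1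
      monotone' := fun i j hij => by
        have h : (f.toOrderHom i).1 ≤ (f.toOrderHom j).1 := f.toOrderHom.monotone hij
        dsimp only
        split_ifs with h1 h2
        · exact le_rfl
        · exact Fin.zero_le _
        · exact absurd (h.trans (by assumption)) h1
        · exact le_rfl }

/-- The value on `f : [m] → [n]`, supposed to be a simplex of `Sp(n)`, of the map `Sp(n) ⟶ Y`
determined by a path. -/
def spineDescFun {Y : SSet.{u}} {n : ℕ} (p : Y.Path n) {m : SimplexCategory} (f : m ⟶ ⦋n⦌) :
    Y.obj (op m) :=
  if h : (f.toOrderHom 0).1 < n then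
    Y.map (cut f (f.toOrderHom 0).1).op (p.arrow ⟨(f.toOrderHom 0).1, h⟩)
  else Y.map (SimplexCategory.const m ⦋0⦌ 0).op (p.vertex (f.toOrderHom 0))

lemma spineDescFun_const {Y : SSet.{u}} {n : ℕ} (p : Y.Path n) {m : SimplexCategory}
    (f : m ⟶ ⦋n⦌) (v : Fin (n + 1)) (hf : ∀ i, f.toOrderHom i = v) :
    spineDescFun p f = Y.map (SimplexCategory.const m ⦋0⦌ 0).op (p.vertex v) := by
  obtain rfl : v = f.toOrderHom 0 := (hf 0).symm
  unfold spineDescFun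
  split_ifs with h
  · have h1 : cut f (f.toOrderHom 0).1 =
        SimplexCategory.const m ⦋0⦌ 0 ≫ SimplexCategory.δ (1 : Fin 2) := by
      ext i : 3
      change (if (f.toOrderHom i).1 ≤ (f.toOrderHom 0).1 then (0 : Fin 2) else 1) = 0
      rw [hf i, if_pos le_rfl]
    have h2 := p.arrow_src ⟨(f.toOrderHom 0).1, h⟩
    rw [h1, op_comp, Functor.map_comp]
    exact congrArg (Y.map (SimplexCategory.const m ⦋0⦌ 0).op) h2
  · rfl

lemma spineDescFun_cut {Y : SSet.{u}} {n : ℕ} (p : Y.Path n) {m : SimplexCategory}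
    (f : m ⟶ ⦋n⦌) (a : Fin n) (h0 : ∀ i, a.1 ≤ (f.toOrderHom i).1)
    (h1 : ∀ i, (f.toOrderHom i).1 ≤ a.1 + 1) :
    spineDescFun p f = Y.map (cut f a.1).op (p.arrow a) := by
  by_cases h : (f.toOrderHom 0).1 = a.1
  · unfold spineDescFun
    rw [dif_pos (h ▸ a.2)]
    congr! 3
    rw [h]
  · have hf : ∀ i, f.toOrderHom i = a.succ := by
      intro i
      have h2 : (f.toOrderHom 0).1 ≤ (f.toOrderHom i).1 := f.toOrderHom.monotone (Fin.zero_le i)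
      have h3 := h0 0
      have h4 := h1 i
      apply Fin.ext
      rw [Fin.val_succ]
      lia
    rw [spineDescFun_const p f a.succ hf]
    have h5 : cut f a.1 = SimplexCategory.const m ⦋0⦌ 0 ≫ SimplexCategory.δ (0 : Fin 2) := by
      ext i : 3
      change (if (f.toOrderHom i).1 ≤ a.1 then (0 : Fin 2) else 1) = 1
      rw [hf i, if_neg (by simp)]
    rw [h5, op_comp, Functor.map_comp]
    exact (congrArg (Y.map (SimplexCategory.const m ⦋0⦌ 0).op) (p.arrow_tgt a)).symm

/-- The map `Sp(n) ⟶ Y` determined by a path of length `n` in `Y`, i.e. by `n` consecutive edges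
(and by a vertex if `n = 0`). -/
def spineDesc {Y : SSet.{u}} {n : ℕ} (p : Y.Path n) : Sp.{u} n ⟶ Y where
  app m := ↾fun s => spineDescFun p (SSet.stdSimplex.objEquiv s.1)
  naturality m m' θ := by
    ext s
    change spineDescFun p (θ.unop ≫ SSet.stdSimplex.objEquiv s.1) =
      Y.map θ (spineDescFun p (SSet.stdSimplex.objEquiv s.1))
    have hs : ∀ i j, ((SSet.stdSimplex.objEquiv s.1).toOrderHom j).1 ≤
      ((SSet.stdSimplex.objEquiv s.1).toOrderHom i).1 + 1 := s.2
    generalize SSet.stdSimplex.objEquiv s.1 = f at hs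
    by_cases h : (f.toOrderHom 0).1 < n
    · have h0 : ∀ i, (f.toOrderHom 0).1 ≤ (f.toOrderHom i).1 :=
        fun i => f.toOrderHom.monotone (Fin.zero_le i)
      rw [spineDescFun_cut p f ⟨_, h⟩ h0 (hs 0),
        spineDescFun_cut p (θ.unop ≫ f) ⟨_, h⟩ (fun i => h0 _) (fun i => hs 0 _)]
      have h1 : (cut (θ.unop ≫ f) (f.toOrderHom 0).1).op = (cut f (f.toOrderHom 0).1).op ≫ θ := rfl
      dsimp only
      rw [h1, Functor.map_comp]
      rfl
    · have h0 : ∀ i, f.toOrderHom i = f.toOrderHom 0 := by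
        intro i
        have h2 : (f.toOrderHom 0).1 ≤ (f.toOrderHom i).1 := f.toOrderHom.monotone (Fin.zero_le i)
        exact Fin.ext (by lia)
      rw [spineDescFun_const p f _ h0, spineDescFun_const p (θ.unop ≫ f) _ (fun i => h0 _)]
      have h1 : (SimplexCategory.const m'.unop ⦋0⦌ 0).op =
        (SimplexCategory.const m.unop ⦋0⦌ 0).op ≫ θ := rfl
      rw [h1, Functor.map_comp]
      rfl

lemma spineDesc_map {Y Z : SSet.{u}} {n : ℕ} (p : Y.Path n) (g : Y ⟶ Z) :
    spineDesc (p.map g) = spineDesc p ≫ g := by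
  ext m s
  change spineDescFun (p.map g) (SSet.stdSimplex.objEquiv s.1) =
    g.app m (spineDescFun p (SSet.stdSimplex.objEquiv s.1))
  unfold spineDescFun
  split_ifs
  · exact (ConcreteCategory.congr_hom (g.naturality _) _).symm
  · exact (ConcreteCategory.congr_hom (g.naturality _) _).symm

lemma spineVertex_spineDesc {Y : SSet.{u}} {n : ℕ} (p : Y.Path n) (i : Fin (n + 1)) :
    SSet.yonedaEquiv (spineVertex i ≫ spineDesc p) = p.vertex i := by
  refine (spineDescFun_const p (SimplexCategory.const ⦋0⦌ ⦋n⦌ i) i (fun _ => rfl)).trans ?_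
  rw [SimplexCategory.const_eq_id, op_id, CategoryTheory.Functor.map_id]
  rfl

lemma spineEdge_spineDesc {Y : SSet.{u}} {n : ℕ} (p : Y.Path n) (i : Fin n) :
    SSet.yonedaEquiv (spineEdge i ≫ spineDesc p) = p.arrow i := by
  refine (spineDescFun_cut p (SimplexCategory.mkOfSucc i) i ?_ ?_).trans ?_
  · intro c
    fin_cases c
    · exact le_rfl
    · exact Nat.le_succ _
  · intro c
    fin_cases c
    · exact Nat.le_succ _
    · exact le_rfl
  · have h : cut (SimplexCategory.mkOfSucc i) i.1 = 𝟙 _ := by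
      ext c : 3
      fin_cases c
      · exact if_pos le_rfl
      · exact if_neg (Nat.not_succ_le_self i.1)
    rw [h, op_id, CategoryTheory.Functor.map_id]
    rfl

/-! ### Segal spaces and `2`-fold Segal spaces -/

/-- A map of simplicial sets is a weak homotopy equivalence if precomposition with it induces
bijections on homotopy classes of maps to all Kan complexes. -/
def IsWeakEquivalence {A B : SSet.{u}} (f : A ⟶ B) : Prop :=
  ∀ Z : SSet.{u}, SSet.KanComplex Z →
    (∀ g h : B ⟶ Z, Nonempty (SSet.Homotopy (f ≫ g) (f ≫ h)) → Nonempty (SSet.Homotopy g h)) ∧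
    ∀ g : A ⟶ Z, ∃ h : B ⟶ Z, Nonempty (SSet.Homotopy (f ≫ h) g)

/-- The map `A_n ⟶ A_K` induced by `j : K ⟶ Δ[n]`. -/
def powerComparison (A : SimplicialSpace.{u}) {K : SSet.{u}} {n : ℕ} (j : K ⟶ Δ[n]) :
    A.obj (op ⦋n⦌) ⟶ (power K).obj A :=
  (powerSimplexIso n).inv.app A ≫ (powerMap j).app A

/-- The map `X_n ⟶ X_K` induced by `j : K ⟶ Δ[n]`. -/
def comparison (X : BisimplicialSpace.{u}) {K : SSet.{u}} {n : ℕ} (j : K ⟶ Δ[n]) :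
    X.obj (op ⦋n⦌) ⟶ mapSpace X K :=
  (mapSpaceSimplexIso X n).inv ≫ restrict X j

/-- The relative matching map `A_k ⟶ B_k ×_{B_{∂Δ[k]}} A_{∂Δ[k]}` of `f : A ⟶ B`. -/
noncomputable def relativeMatchingMap {A B : SimplicialSpace.{u}} (f : A ⟶ B) (k : ℕ) :
    A.obj (op ⦋k⦌) ⟶
      pullback (powerComparison B (SSet.boundary.{u} k).ι) ((power _).map f) :=
  pullback.lift (f.app (op ⦋k⦌)) (powerComparison A (SSet.boundary.{u} k).ι)
    (((powerSimplexIso k).inv ≫ powerMap (SSet.boundary.{u} k).ι).naturality f)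

open SSet.modelCategoryQuillen in
/-- Reedy fibrations of simplicial spaces. -/
def IsReedyFibration {A B : SimplicialSpace.{u}} (f : A ⟶ B) : Prop :=
  ∀ k : ℕ, Fibration (relativeMatchingMap f k)

/-- Reedy fibrant simplicial spaces: the map to the terminal object is a Reedy fibration, that is,
all matching maps `A_k ⟶ A_{∂Δ[k]}` are Kan fibrations. -/
def IsReedyFibrant (A : SimplicialSpace.{u}) : Prop :=
  IsReedyFibration (terminal.from A)

/-- Reedy fibrant bisimplicial spaces: all matching maps `X_k ⟶ X_{∂Δ[k]}` are Reedy fibrations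
of simplicial spaces. -/
def IsBiReedyFibrant (X : BisimplicialSpace.{u}) : Prop :=
  ∀ k : ℕ, IsReedyFibration (comparison X (SSet.boundary.{u} k).ι)

/-- A Segal space is a Reedy fibrant simplicial space whose Segal maps
`A_n ⟶ A_{Sp(n)} = A_1 ×_{A_0} ⋯ ×_{A_0} A_1` are weak equivalences for `n ≥ 2`. -/
structure IsSegalSpace (A : SimplicialSpace.{u}) : Prop where
  fibrant : IsReedyFibrant A
  segal : ∀ n : ℕ, 2 ≤ n → IsWeakEquivalence (powerComparison A (spine.{u} n).ι)

/-- Two maps `f, g : A ⟶ B` of simplicial spaces are homotopic if there is a map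
`A × Δ[1] ⟶ B`, where `Δ[1]` is considered as a constant simplicial space, from `f` to `g`. -/
def SpaceHomotopic {A B : SimplicialSpace.{u}} (f g : A ⟶ B) : Prop :=
  ∃ H : A ⋙ tensorRight (Δ[1] : SSet.{u}) ⟶ B,
    ∀ n, SSet.ι₀ ≫ H.app n = f.app n ∧ SSet.ι₁ ≫ H.app n = g.app n

/-- A map of simplicial spaces is a weak equivalence in the model structure for Segal spaces (the
left Bousfield localization of the Reedy model structure whose fibrant objects are the Segal
spaces) if precomposition with it induces bijections on homotopy classes of maps to all Segal
spaces. -/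
def IsSegalWeakEquivalence {A B : SimplicialSpace.{u}} (f : A ⟶ B) : Prop :=
  ∀ W : SimplicialSpace.{u}, IsSegalSpace W →
    (∀ g h : B ⟶ W, SpaceHomotopic (f ≫ g) (f ≫ h) → SpaceHomotopic g h) ∧
    ∀ g : A ⟶ W, ∃ h : B ⟶ W, SpaceHomotopic (f ≫ h) g

/-- The natural map from the constant simplicial space on `A_0` to `A`. -/
def fromConstant (A : SimplicialSpace.{u}) :
    (Functor.const SimplexCategoryᵒᵖ).obj (A.obj (op ⦋0⦌)) ⟶ A where
  app m := A.map (SimplexCategory.const m.unop ⦋0⦌ 0).op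
  naturality m m' θ := by
    have h : (SimplexCategory.const m'.unop ⦋0⦌ 0).op =
      (SimplexCategory.const m.unop ⦋0⦌ 0).op ≫ θ := rfl
    rw [h, Functor.map_comp]
    exact Category.id_comp _

/-- Essentially constant Segal spaces. -/
def IsEssentiallyConstant (A : SimplicialSpace.{u}) : Prop :=
  IsSegalWeakEquivalence (fromConstant A)

/-- The Segal map `γ_n : X_n ⟶ X_{Sp(n)} = X_1 ×_{X_0} ⋯ ×_{X_0} X_1`. -/
def segalMap (X : BisimplicialSpace.{u}) (n : ℕ) : X.obj (op ⦋n⦌) ⟶ mapSpace X (Sp n) :=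
  comparison X (spine n).ι

/-- A double Segal space is a Reedy fibrant bisimplicial space such that the Segal maps
`X_{n,•} ⟶ X_{1,•} ×_{X_{0,•}} ⋯ ×_{X_{0,•}} X_{1,•}` and
`X_{•,n} ⟶ X_{•,1} ×_{X_{•,0}} ⋯ ×_{X_{•,0}} X_{•,1}` are levelwise weak equivalences for all
`n ≥ 2`. -/
structure IsDoubleSegalSpace (X : BisimplicialSpace.{u}) : Prop where
  fibrant : IsBiReedyFibrant X
  segal : ∀ n : ℕ, 2 ≤ n → ∀ m, IsWeakEquivalence ((segalMap X n).app m)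
  segal_flip : ∀ n : ℕ, 2 ≤ n → ∀ m, IsWeakEquivalence ((segalMap X.flip n).app m)

/-- A `2`-fold Segal space is a double Segal space `X` such that the Segal space `X_{0,•}` is
essentially constant. -/
structure IsTwoFoldSegalSpace (X : BisimplicialSpace.{u}) : Prop extends IsDoubleSegalSpace X where
  essentiallyConstant : IsEssentiallyConstant (X.obj (op ⦋0⦌))

/-- A choice of horizontal compositions: sections `μ_n : X_{Sp(n)} ⟶ X_n` of the Segal maps.
For `n = 0` and `n = 1` the Segal map is an isomorphism, so `μ_n` is its inverse (the identity under
the identifications `X_{Sp(0)} = X_0` and `X_{Sp(1)} = X_1`). -/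
structure HorizontalCompositions (X : BisimplicialSpace.{u}) where
  μ : ∀ n : ℕ, mapSpace X (Sp n) ⟶ X.obj (op ⦋n⦌)
  section_ : ∀ n : ℕ, μ n ≫ segalMap X n = 𝟙 _

/-! ### Mapping spaces -/

/-- The objects of `X`, i.e. the elements of `(X_{0,0})_0`. -/
abbrev Ob (X : BisimplicialSpace.{u}) : Type u :=
  ((X.obj (op ⦋0⦌)).obj (op ⦋0⦌)).obj (op ⦋0⦌)

/-- The map from the terminal simplicial space to `X_0` given by an object of `X`. -/
noncomputable def point (X : BisimplicialSpace.{u}) (x : Ob X) :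
    ⊤_ SimplicialSpace.{u} ⟶ X.obj (op ⦋0⦌) where
  app j := SSet.const x ≫ (X.obj (op ⦋0⦌)).map (SimplexCategory.const j.unop ⦋0⦌ 0).op
  naturality j j' θ := by
    have h : (SimplexCategory.const j'.unop ⦋0⦌ 0).op =
      (SimplexCategory.const j.unop ⦋0⦌ 0).op ≫ θ := rfl
    rw [h, Functor.map_comp]
    rfl

section Fibre

variable {X : BisimplicialSpace.{u}} {A B : SimplicialSpace.{u}}

/-- The fibre `A^{x,y} = {(x, y)} ×_{X_0 × X_0} A` of a simplicial space `A` over `X_0 × X_0`. -/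
noncomputable abbrev fibre (s t : A ⟶ X.obj (op ⦋0⦌)) (x y : Ob X) : SimplicialSpace.{u} :=
  pullback (prod.lift (point X x) (point X y)) (prod.lift s t)

/-- The map `f^{x,y} : A^{x,y} ⟶ B^{x,y}` induced by a map `f : A ⟶ B` over `X_0 × X_0`. -/
noncomputable def fibreMap {s t : A ⟶ X.obj (op ⦋0⦌)} {s' t' : B ⟶ X.obj (op ⦋0⦌)} (f : A ⟶ B)
    (hs : f ≫ s' = s) (ht : f ≫ t' = t) (x y : Ob X) : fibre s t x y ⟶ fibre s' t' x y :=
  pullback.lift (pullback.fst _ _) (pullback.snd _ _ ≫ f) (by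
    rw [pullback.condition, Category.assoc, prod.comp_lift, prod.comp_lift, prod.comp_lift, hs, ht])

end Fibre

/-- The source map `X_1 ⟶ X_0`. -/
def src (X : BisimplicialSpace.{u}) : X.obj (op ⦋1⦌) ⟶ X.obj (op ⦋0⦌) :=
  X.map (SimplexCategory.const ⦋0⦌ ⦋1⦌ 0).op

/-- The target map `X_1 ⟶ X_0`. -/
def tgt (X : BisimplicialSpace.{u}) : X.obj (op ⦋1⦌) ⟶ X.obj (op ⦋0⦌) :=
  X.map (SimplexCategory.const ⦋0⦌ ⦋1⦌ 1).op

/-- The mapping space `X(x, y) = {(x, y)} ×_{X_0 × X_0} X_1`. -/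
noncomputable abbrev homSpace (X : BisimplicialSpace.{u}) (x y : Ob X) : SimplicialSpace.{u} :=
  fibre (src X) (tgt X) x y

/-- The evaluation `X_K ⟶ X_0` at a vertex of `K`. -/
def evalVertex (X : BisimplicialSpace.{u}) {K : SSet.{u}} (v : Δ[0] ⟶ K) :
    mapSpace X K ⟶ X.obj (op ⦋0⦌) :=
  restrict X v ≫ (mapSpaceSimplexIso X 0).hom

/-- The evaluation `X_K ⟶ X_1` at an edge of `K`. -/
def evalEdge (X : BisimplicialSpace.{u}) {K : SSet.{u}} (e : Δ[1] ⟶ K) :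
    mapSpace X K ⟶ X.obj (op ⦋1⦌) :=
  restrict X e ≫ (mapSpaceSimplexIso X 1).hom

lemma evalEdge_src (X : BisimplicialSpace.{u}) {K : SSet.{u}} (e : Δ[1] ⟶ K) :
    evalEdge X e ≫ src X =
      evalVertex X (SSet.stdSimplex.map (SimplexCategory.const ⦋0⦌ ⦋1⦌ 0) ≫ e) := by
  ext j m φ
  exact (SSet.yonedaEquiv_naturality (X := column X j m) _ _)

lemma evalEdge_tgt (X : BisimplicialSpace.{u}) {K : SSet.{u}} (e : Δ[1] ⟶ K) :
    evalEdge X e ≫ tgt X =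
      evalVertex X (SSet.stdSimplex.map (SimplexCategory.const ⦋0⦌ ⦋1⦌ 1) ≫ e) := by
  ext j m φ
  exact (SSet.yonedaEquiv_naturality (X := column X j m) _ _)


section Inclusion

variable (X : BisimplicialSpace.{u}) {n : ℕ} (x : Fin (n + 1) → Ob X)

/-- The product `∏_{i=1}^n X(x_{i-1}, x_i)`. For `n = 0` it is the terminal object. -/
noncomputable abbrev homProduct : SimplicialSpace.{u} :=
  ∏ᶜ fun i : Fin n => homSpace X (x i.castSucc) (x i.succ)

/-- The projection of `∏_{i=1}^n X(x_{i-1}, x_i)` to the `i`-th copy of `X_1`. -/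
noncomputable def homProductEdge (i : Fin n) : homProduct X x ⟶ X.obj (op ⦋1⦌) :=
  Pi.π _ i ≫ pullback.snd _ _

lemma homProductEdge_src (i : Fin n) :
    homProductEdge X x i ≫ src X = terminal.from _ ≫ point X (x i.castSucc) := by
  have h := (pullback.condition (f := prod.lift (point X (x i.castSucc)) (point X (x i.succ)))
    (g := prod.lift (src X) (tgt X))) =≫ prod.fst
  rw [Category.assoc, Category.assoc, prod.lift_fst, prod.lift_fst] at h
  rw [homProductEdge, Category.assoc, ← h, ← Category.assoc]
  congr 1
  exact Subsingleton.elim _ _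

lemma homProductEdge_tgt (i : Fin n) :
    homProductEdge X x i ≫ tgt X = terminal.from _ ≫ point X (x i.succ) := by
  have h := (pullback.condition (f := prod.lift (point X (x i.castSucc)) (point X (x i.succ)))
    (g := prod.lift (src X) (tgt X))) =≫ prod.snd
  rw [Category.assoc, Category.assoc, prod.lift_snd, prod.lift_snd] at h
  rw [homProductEdge, Category.assoc, ← h, ← Category.assoc]
  congr 1
  exact Subsingleton.elim _ _

lemma const_zero_eq_δ : SimplexCategory.const ⦋0⦌ ⦋1⦌ 0 = SimplexCategory.δ (1 : Fin 2) := by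
  ext i : 3
  fin_cases i
  rfl

lemma const_one_eq_δ : SimplexCategory.const ⦋0⦌ ⦋1⦌ 1 = SimplexCategory.δ (0 : Fin 2) := by
  ext i : 3
  fin_cases i
  rfl

/-- An element of `∏_{i=1}^n X(x_{i-1}, x_i)` as a path of length `n` through the objects
`x_0, …, x_n`. -/
noncomputable def homProductPath (j m : SimplexCategoryᵒᵖ)
    (p : ((homProduct X x).obj j).obj m) : SSet.Path (column X j m) n where
  vertex i := ((terminal.from (homProduct X x) ≫ point X (x i)).app j).app m p
  arrow i := ((homProductEdge X x i).app j).app m p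
  arrow_src i := by
    have h := ConcreteCategory.congr_hom
      (NatTrans.congr_app (NatTrans.congr_app (homProductEdge_src X x i) j) m) p
    rw [src, const_zero_eq_δ] at h
    exact h
  arrow_tgt i := by
    have h := ConcreteCategory.congr_hom
      (NatTrans.congr_app (NatTrans.congr_app (homProductEdge_tgt X x i) j) m) p
    rw [tgt, const_one_eq_δ] at h
    exact h

/-- The inclusion `∏_{i=1}^n X(x_{i-1}, x_i) ⟶ X_{Sp(n)}`. -/
noncomputable def homProductToSpine : homProduct X x ⟶ mapSpace X (Sp n) where
  app j :=
    { app := fun m => ↾fun p => spineDesc (homProductPath X x j m p)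
      naturality := fun m m' θ => by
        ext p
        change spineDesc (homProductPath X x j m' (((homProduct X x).obj j).map θ p)) =
          spineDesc (homProductPath X x j m p) ≫ (X.flip.obj j).flip.map θ
        rw [← spineDesc_map]
        congr 1
        refine SSet.Path.ext ?_ ?_
        · funext i
          exact ConcreteCategory.congr_hom
            (((terminal.from (homProduct X x) ≫ point X (x i)).app j).naturality θ) p
        · funext i
          exact ConcreteCategory.congr_hom (((homProductEdge X x i).app j).naturality θ) p }
  naturality j j' θ := by
    ext m p
    change spineDesc (homProductPath X x j' m (((homProduct X x).map θ).app m p)) =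
      spineDesc (homProductPath X x j m p) ≫ ((flipFunctor _ _ _).map (X.flip.map θ)).app m
    rw [← spineDesc_map]
    congr 1
    refine SSet.Path.ext ?_ ?_
    · funext i
      exact ConcreteCategory.congr_hom (NatTrans.congr_app
        ((terminal.from (homProduct X x) ≫ point X (x i)).naturality θ) m) p
    · funext i
      exact ConcreteCategory.congr_hom (NatTrans.congr_app
        ((homProductEdge X x i).naturality θ) m) p

lemma homProductToSpine_evalVertex (i : Fin (n + 1)) :
    homProductToSpine X x ≫ evalVertex X (spineVertex i) =
      terminal.from _ ≫ point X (x i) := by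
  ext j m p
  exact spineVertex_spineDesc (homProductPath X x j m p) i

/-- The inclusion `∏_{i=1}^n X(x_{i-1}, x_i) ⟶ X_{Sp(n)}^{x_0,x_n}`. -/
noncomputable def homProductInclusion :
    homProduct X x ⟶ fibre (evalVertex X (spineVertex (0 : Fin (n + 1))))
      (evalVertex X (spineVertex (Fin.last n))) (x 0) (x (Fin.last n)) :=
  pullback.lift (terminal.from _) (homProductToSpine X x) (by
    rw [prod.comp_lift, prod.comp_lift, homProductToSpine_evalVertex,
      homProductToSpine_evalVertex])

end Inclusion

/-! ### Simplicial composition diagrams -/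

/-- Cospans `Sp(n) ⟶ K ⟵ Δ[1]` of simplicial sets. -/
structure CompCospan (n : ℕ) where
  K : SSet.{u}
  ι : Sp.{u} n ⟶ K
  τ : Δ[1] ⟶ K

/-- The cospan `Sp(n) ⟶ Δ[n] ⟵ Δ[1]` of the spine inclusion and the edge `⟨0, n⟩`. -/
def CompCospan.simplex (n : ℕ) : CompCospan.{u} n where
  K := Δ[n]
  ι := (spine n).ι
  τ := SSet.stdSimplex.map (SimplexCategory.diag n)

/-- The sum of the sizes of the blocks before the `i`-th one. -/
def blockStart {n : ℕ} (k : Fin n → ℕ) (i : Fin n) : ℕ := ∑ j ∈ Finset.Iio i, k j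

lemma blockStart_add_le {n : ℕ} (k : Fin n → ℕ) (i : Fin n) {r : ℕ} (hr : r = ∑ j, k j) :
    blockStart k i + k i ≤ r := by
  rw [hr, blockStart, add_comm, ← Finset.sum_insert (by simp)]
  exact Finset.sum_le_sum_of_subset (Finset.subset_univ _)

/-- The condition that maps `f_i : K_i ⟶ Z` out of cospans are compatible with gluing the last
spine vertex of each `K_i` to the first spine vertex of `K_{i+1}`. -/
def IsGlued {n : ℕ} {k : Fin n → ℕ} (D : ∀ i, CompCospan.{u} (k i)) {Z : SSet.{u}}
    (f : ∀ i, (D i).K ⟶ Z) : Prop :=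
  ∀ i j : Fin n, i.1 + 1 = j.1 →
    spineVertex (Fin.last (k i)) ≫ (D i).ι ≫ f i = spineVertex 0 ≫ (D j).ι ≫ f j

/-- Data exhibiting a cospan `Sp(r) ⟶ K ⟵ Δ[1]`, with `r = k_1 + ⋯ + k_n`, as the grafting
`K = (K_1 ⊔_{Δ[0]} ⋯ ⊔_{Δ[0]} K_n) ⊔_{Sp(n)} K_0` of cospans `Sp(k_i) ⟶ K_i ⟵ Δ[1]` onto a cospan
`Sp(n) ⟶ K_0 ⟵ Δ[1]`. -/
structure Grafting {n : ℕ} {k : Fin n → ℕ} (D : ∀ i, CompCospan.{u} (k i)) (C₀ : CompCospan.{u} n)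
    {r : ℕ} (C : CompCospan.{u} r) where
  arity : r = ∑ i, k i
  /-- The wedge `K_1 ⊔_{Δ[0]} ⋯ ⊔_{Δ[0]} K_n`. -/
  W : SSet.{u}
  inc : ∀ i, (D i).K ⟶ W
  glued : IsGlued D inc
  existsUnique_desc : ∀ (Z : SSet.{u}) (f : ∀ i, (D i).K ⟶ Z), IsGlued D f →
    ∃! g : W ⟶ Z, ∀ i, inc i ≫ g = f i
  /-- The map `ι_1 ⊔ ⋯ ⊔ ι_n : Sp(r) = Sp(k_1) ⊔_{Δ[0]} ⋯ ⊔_{Δ[0]} Sp(k_n) ⟶ W`. -/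
  ιW : Sp.{u} r ⟶ W
  sub_ιW : ∀ i, spineSub (blockStart k i) (k i) (blockStart_add_le k i arity) ≫ ιW =
    (D i).ι ≫ inc i
  /-- The map `τ_1 ⊔ ⋯ ⊔ τ_n : Sp(n) = Δ[1] ⊔_{Δ[0]} ⋯ ⊔_{Δ[0]} Δ[1] ⟶ W`. -/
  τW : Sp.{u} n ⟶ W
  edge_τW : ∀ i, spineEdge i ≫ τW = (D i).τ ≫ inc i
  inl : W ⟶ C.K
  inr : C₀.K ⟶ C.K
  isPushout : IsPushout τW C₀.ι inl inr
  ι_eq : C.ι = ιW ≫ inl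
  τ_eq : C.τ = C₀.τ ≫ inr

end Spaces

/-- Simplicial composition diagrams of arity `n`: an element of `SCD C` is an inductive construction
of the cospan `C`, up to isomorphism, either as `Sp(n) ⟶ Δ[n] ⟵ Δ[1]` or as
`(K_1 ⊔_{Δ[0]} ⋯ ⊔_{Δ[0]} K_d) ⊔_{Sp(d)} Δ[d]` for `d > 1` and simplicial composition diagrams
`K_1, …, K_d`. -/
inductive SCD : {n : ℕ} → CompCospan.{u} n → Type (u + 1) where
  | simplex {n : ℕ} {C : CompCospan.{u} n} (e : (CompCospan.simplex n).K ≅ C.K)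
      (hι : (CompCospan.simplex n).ι ≫ e.hom = C.ι)
      (hτ : (CompCospan.simplex n).τ ≫ e.hom = C.τ) : SCD C
  | graft {d : ℕ} (hd : 1 < d) {k : Fin d → ℕ} {D : ∀ i, CompCospan.{u} (k i)}
      (S : ∀ i, SCD (D i)) {r : ℕ} {C : CompCospan.{u} r}
      (G : Grafting D (CompCospan.simplex d) C) : SCD C

section Induced

open Simplicial

lemma spineVertex_spineSub {r : ℕ} (a k : ℕ) (h : a + k ≤ r) (i : Fin (k + 1)) :
    spineVertex.{u} i ≫ spineSub a k h = spineVertex ⟨a + i, by lia⟩ := by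
  rw [← cancel_mono (spine r).ι]
  refine (SSet.stdSimplex.map_comp (SimplexCategory.const ⦋0⦌ ⦋k⦌ i)
    (SimplexCategory.subinterval a k h)).symm.trans (congrArg SSet.stdSimplex.map ?_)
  ext c : 3
  exact Fin.ext (Nat.add_comm _ _)

lemma spineVertex_ι {n : ℕ} (i : Fin (n + 1)) :
    spineVertex.{u} i ≫ (spine n).ι =
      SSet.stdSimplex.map (SimplexCategory.const ⦋0⦌ ⦋n⦌ i) := rfl

lemma spineEdge_source {n : ℕ} (i : Fin n) :
    SSet.stdSimplex.map (SimplexCategory.const ⦋0⦌ ⦋1⦌ 0) ≫ spineEdge.{u} i =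
      spineVertex i.castSucc := by
  rw [← cancel_mono (spine n).ι]
  exact (SSet.stdSimplex.map_comp (SimplexCategory.const ⦋0⦌ ⦋1⦌ 0)
    (SimplexCategory.mkOfSucc i)).symm

lemma spineEdge_target {n : ℕ} (i : Fin n) :
    SSet.stdSimplex.map (SimplexCategory.const ⦋0⦌ ⦋1⦌ 1) ≫ spineEdge.{u} i =
      spineVertex i.succ := by
  rw [← cancel_mono (spine n).ι]
  exact (SSet.stdSimplex.map_comp (SimplexCategory.const ⦋0⦌ ⦋1⦌ 1)
    (SimplexCategory.mkOfSucc i)).symm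

lemma blockStart_zero {n : ℕ} (k : Fin n → ℕ) (hn : 0 < n) : blockStart k ⟨0, hn⟩ = 0 :=
  Finset.sum_eq_zero (fun i hi => absurd (Finset.mem_Iio.1 hi) (by simp [Fin.lt_def]))

lemma blockStart_succ {n : ℕ} (k : Fin n → ℕ) (i j : Fin n) (h : i.1 + 1 = j.1) :
    blockStart k j = blockStart k i + k i := by
  rw [blockStart, blockStart, add_comm, ← Finset.sum_insert (by simp)]
  congr 1
  ext l
  simp only [Finset.mem_insert, Finset.mem_Iio]
  rw [Fin.lt_def, Fin.lt_def, Fin.ext_iff]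
  lia

lemma blockStart_last {n : ℕ} (k : Fin n → ℕ) (hn : 0 < n) :
    blockStart k ⟨n - 1, by lia⟩ + k ⟨n - 1, by lia⟩ = ∑ i, k i := by
  rw [blockStart, add_comm, ← Finset.sum_insert (by simp)]
  congr 1
  ext i
  simp only [Finset.mem_insert, Finset.mem_Iio, Finset.mem_univ, iff_true]
  have := i.2
  rw [Fin.lt_def, Fin.ext_iff]
  dsimp only
  lia

/-- The endpoints of `τ` and `ι` agree. -/
def EndpointsAgree {n : ℕ} (C : CompCospan.{u} n) : Prop :=
  SSet.stdSimplex.map (SimplexCategory.const ⦋0⦌ ⦋1⦌ 0) ≫ C.τ = spineVertex 0 ≫ C.ι ∧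
    SSet.stdSimplex.map (SimplexCategory.const ⦋0⦌ ⦋1⦌ 1) ≫ C.τ =
      spineVertex (Fin.last n) ≫ C.ι

namespace Grafting

variable {n : ℕ} {k : Fin n → ℕ} {D : ∀ i, CompCospan.{u} (k i)} {C₀ : CompCospan.{u} n}
  {r : ℕ} {C : CompCospan.{u} r} (G : Grafting D C₀ C)

lemma lastBlock (G : Grafting D C₀ C) (hn : 0 < n) :
    blockStart k ⟨n - 1, by lia⟩ + k ⟨n - 1, by lia⟩ = r :=
  (blockStart_last k hn).trans G.arity.symm

lemma first_vertex (hn : 0 < n) (hD : ∀ i, EndpointsAgree (D i)) :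
    spineVertex 0 ≫ G.τW = spineVertex 0 ≫ G.ιW := by
  have h1 := G.edge_τW ⟨0, hn⟩
  have h2 := G.sub_ιW ⟨0, hn⟩
  have h3 : spineVertex.{u} (0 : Fin (n + 1)) =
      SSet.stdSimplex.map (SimplexCategory.const ⦋0⦌ ⦋1⦌ 0) ≫ spineEdge ⟨0, hn⟩ :=
    (spineEdge_source ⟨0, hn⟩).symm
  have h4 : spineVertex.{u} (0 : Fin (r + 1)) =
      spineVertex 0 ≫ spineSub _ _ (blockStart_add_le k ⟨0, hn⟩ G.arity) := by
    rw [spineVertex_spineSub]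
    congr 1
    exact Fin.ext (blockStart_zero k hn).symm
  rw [h3, h4, Category.assoc, Category.assoc, h1, h2, ← Category.assoc, (hD _).1, Category.assoc]

lemma last_vertex (hn : 0 < n) (hD : ∀ i, EndpointsAgree (D i)) :
    spineVertex (Fin.last n) ≫ G.τW = spineVertex (Fin.last r) ≫ G.ιW := by
  have h1 := G.edge_τW ⟨n - 1, by lia⟩
  have h2 := G.sub_ιW ⟨n - 1, by lia⟩
  have h3 : spineVertex.{u} (Fin.last n) =
      SSet.stdSimplex.map (SimplexCategory.const ⦋0⦌ ⦋1⦌ 1) ≫ spineEdge ⟨n - 1, by lia⟩ := by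
    rw [spineEdge_target]
    congr 1
    exact Fin.ext (by simp; lia)
  have h4 : spineVertex.{u} (Fin.last r) = spineVertex (Fin.last _) ≫
      spineSub _ _ (blockStart_add_le k ⟨n - 1, by lia⟩ G.arity) := by
    rw [spineVertex_spineSub]
    congr 1
    exact Fin.ext (G.lastBlock hn).symm
  rw [h3, h4, Category.assoc, Category.assoc, h1, h2, ← Category.assoc, (hD _).2, Category.assoc]

lemma endpointsAgree (G : Grafting D C₀ C) (hn : 0 < n) (hD : ∀ i, EndpointsAgree (D i)) (h₀ : EndpointsAgree C₀) :
    EndpointsAgree C := by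
  constructor
  · rw [G.τ_eq, G.ι_eq, ← Category.assoc, h₀.1, Category.assoc, ← G.isPushout.w,
      ← Category.assoc, G.first_vertex hn hD, Category.assoc]
  · rw [G.τ_eq, G.ι_eq, ← Category.assoc, h₀.2, Category.assoc, ← G.isPushout.w,
      ← Category.assoc, G.last_vertex hn hD, Category.assoc]

end Grafting

lemma endpointsAgree_simplex (n : ℕ) : EndpointsAgree (CompCospan.simplex.{u} n) :=
  ⟨(SSet.stdSimplex.map_comp (SimplexCategory.const ⦋0⦌ ⦋1⦌ 0) (SimplexCategory.diag n)).symm,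
    (SSet.stdSimplex.map_comp (SimplexCategory.const ⦋0⦌ ⦋1⦌ 1) (SimplexCategory.diag n)).symm⟩

lemma SCD.endpointsAgree {n : ℕ} {C : CompCospan.{u} n} (S : SCD C) : EndpointsAgree C := by
  induction S with
  | simplex e hι hτ =>
    rw [EndpointsAgree, ← hι, ← hτ, ← Category.assoc, ← Category.assoc, ← Category.assoc,
      ← Category.assoc, (endpointsAgree_simplex _).1, (endpointsAgree_simplex _).2]
    exact ⟨rfl, rfl⟩
  | graft hd S G ih =>
    exact G.endpointsAgree (by lia) ih (endpointsAgree_simplex _)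

/-! ### The induced compositions -/

section Lift

variable (X : BisimplicialSpace.{u})

/-- A map `Z ⟶ X_K` from a natural family of maps `K ⟶ X_{•,j,m}`. -/
def mapSpaceLift {K : SSet.{u}} {Z : SimplicialSpace.{u}}
    (φ : ∀ j m, (Z.obj j).obj m → (K ⟶ column X j m))
    (h₁ : ∀ j j' (θ : j ⟶ j') m z, φ j' m ((Z.map θ).app m z) =
      φ j m z ≫ ((flipFunctor _ _ _).map (X.flip.map θ)).app m)
    (h₂ : ∀ j m m' (θ : m ⟶ m') z, φ j m' ((Z.obj j).map θ z) =
      φ j m z ≫ (X.flip.obj j).flip.map θ) : Z ⟶ mapSpace X K where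
  app j :=
    { app := fun m => ↾fun z => φ j m z
      naturality := fun m m' θ => by
        ext z
        exact h₂ j m m' θ z }
  naturality j j' θ := by
    ext m z
    exact h₁ j j' θ m z

/-- An element of `(X_K)_{j,m}` as a map `K ⟶ X_{•,j,m}`. -/
def toColumn {K : SSet.{u}} {j m : SimplexCategoryᵒᵖ} (z : ((mapSpace X K).obj j).obj m) :
    K ⟶ column X j m := z

variable {X}

lemma toColumn_map {K : SSet.{u}} {Z : SimplicialSpace.{u}} (f : Z ⟶ mapSpace X K)
    {j j' : SimplexCategoryᵒᵖ} (θ : j ⟶ j') (m : SimplexCategoryᵒᵖ) (z : (Z.obj j).obj m) :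
    toColumn X ((f.app j').app m ((Z.map θ).app m z)) =
      toColumn X ((f.app j).app m z) ≫ ((flipFunctor _ _ _).map (X.flip.map θ)).app m :=
  ConcreteCategory.congr_hom (NatTrans.congr_app (f.naturality θ) m) z

lemma toColumn_obj_map {K : SSet.{u}} {Z : SimplicialSpace.{u}} (f : Z ⟶ mapSpace X K)
    (j : SimplexCategoryᵒᵖ) {m m' : SimplexCategoryᵒᵖ} (θ : m ⟶ m') (z : (Z.obj j).obj m) :
    toColumn X ((f.app j).app m' ((Z.obj j).map θ z)) =
      toColumn X ((f.app j).app m z) ≫ (X.flip.obj j).flip.map θ :=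
  ConcreteCategory.congr_hom ((f.app j).naturality θ) z

lemma mapSpace_hom_ext {K : SSet.{u}} {Z : SimplicialSpace.{u}} {f g : Z ⟶ mapSpace X K}
    (h : ∀ j m z, toColumn X ((f.app j).app m z) = toColumn X ((g.app j).app m z)) : f = g := by
  ext j m z
  exact h j m z

lemma toColumn_w {I A B : SSet.{u}} {a : I ⟶ A} {b : I ⟶ B} {Z : SimplicialSpace.{u}}
    {f : Z ⟶ mapSpace X A} {g : Z ⟶ mapSpace X B} (w : f ≫ restrict X a = g ≫ restrict X b)
    (j m : SimplexCategoryᵒᵖ) (z : (Z.obj j).obj m) :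
    a ≫ toColumn X ((f.app j).app m z) = b ≫ toColumn X ((g.app j).app m z) :=
  ConcreteCategory.congr_hom (NatTrans.congr_app (NatTrans.congr_app w j) m) z

/-- `X_{(-)}` sends pushouts to pullbacks: the map into `X_P` induced by compatible maps into `X_A`
and `X_B`. -/
noncomputable def pushoutLift {I A B P : SSet.{u}} {a : I ⟶ A} {b : I ⟶ B} {inl : A ⟶ P}
    {inr : B ⟶ P} (h : IsPushout a b inl inr) {Z : SimplicialSpace.{u}}
    (f : Z ⟶ mapSpace X A) (g : Z ⟶ mapSpace X B) (w : f ≫ restrict X a = g ≫ restrict X b) :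
    Z ⟶ mapSpace X P :=
  mapSpaceLift X
    (fun j m z => h.desc (toColumn X ((f.app j).app m z)) (toColumn X ((g.app j).app m z))
      (toColumn_w w j m z))
    (fun _ _ θ m z => h.hom_ext
      ((h.inl_desc _ _ _).trans ((toColumn_map f θ m z).trans (h.inl_desc_assoc _ _ _ _).symm))
      ((h.inr_desc _ _ _).trans ((toColumn_map g θ m z).trans (h.inr_desc_assoc _ _ _ _).symm)))
    (fun j _ _ θ z => h.hom_ext
      ((h.inl_desc _ _ _).trans ((toColumn_obj_map f j θ z).trans (h.inl_desc_assoc _ _ _ _).symm))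
      ((h.inr_desc _ _ _).trans ((toColumn_obj_map g j θ z).trans (h.inr_desc_assoc _ _ _ _).symm)))

lemma pushoutLift_inl {I A B P : SSet.{u}} {a : I ⟶ A} {b : I ⟶ B} {inl : A ⟶ P}
    {inr : B ⟶ P} (h : IsPushout a b inl inr) {Z : SimplicialSpace.{u}}
    (f : Z ⟶ mapSpace X A) (g : Z ⟶ mapSpace X B) (w : f ≫ restrict X a = g ≫ restrict X b) :
    pushoutLift h f g w ≫ restrict X inl = f :=
  mapSpace_hom_ext fun _ _ _ => h.inl_desc _ _ _

lemma pushoutLift_inr {I A B P : SSet.{u}} {a : I ⟶ A} {b : I ⟶ B} {inl : A ⟶ P}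
    {inr : B ⟶ P} (h : IsPushout a b inl inr) {Z : SimplicialSpace.{u}}
    (f : Z ⟶ mapSpace X A) (g : Z ⟶ mapSpace X B) (w : f ≫ restrict X a = g ≫ restrict X b) :
    pushoutLift h f g w ≫ restrict X inr = g :=
  mapSpace_hom_ext fun _ _ _ => h.inr_desc _ _ _

end Lift

namespace Grafting

variable {n : ℕ} {k : Fin n → ℕ} {D : ∀ i, CompCospan.{u} (k i)} {C₀ : CompCospan.{u} n}
  {r : ℕ} {C : CompCospan.{u} r} (G : Grafting D C₀ C) {X : BisimplicialSpace.{u}}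

lemma wedge_hom_ext {Z : SSet.{u}} {f g : G.W ⟶ Z} (h : ∀ i, G.inc i ≫ f = G.inc i ≫ g) :
    f = g := by
  refine (G.existsUnique_desc Z (fun i => G.inc i ≫ g) ?_).unique h (fun _ => rfl)
  intro i j hij
  simpa only [Category.assoc] using G.glued i j hij =≫ g

/-- The map out of the wedge induced by a compatible family of maps. -/
noncomputable def wedgeDesc {Z : SSet.{u}} (f : ∀ i, (D i).K ⟶ Z) (hf : IsGlued D f) : G.W ⟶ Z :=
  (G.existsUnique_desc Z f hf).choose

lemma inc_wedgeDesc {Z : SSet.{u}} (f : ∀ i, (D i).K ⟶ Z) (hf : IsGlued D f) (i : Fin n) :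
    G.inc i ≫ G.wedgeDesc f hf = f i :=
  (G.existsUnique_desc Z f hf).choose_spec.1 i

lemma inc_wedgeDesc_assoc {Z Y : SSet.{u}} (f : ∀ i, (D i).K ⟶ Z) (hf : IsGlued D f) (i : Fin n)
    (h : Z ⟶ Y) : G.inc i ≫ G.wedgeDesc f hf ≫ h = f i ≫ h := by
  rw [← Category.assoc, inc_wedgeDesc]

lemma isGlued_toColumn {Z : SimplicialSpace.{u}} {f : ∀ i, Z ⟶ mapSpace X (D i).K}
    (hf : ∀ i j : Fin n, i.1 + 1 = j.1 →
      f i ≫ restrict X (spineVertex (Fin.last (k i)) ≫ (D i).ι) =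
        f j ≫ restrict X (spineVertex 0 ≫ (D j).ι)) (j m : SimplexCategoryᵒᵖ)
    (z : (Z.obj j).obj m) : IsGlued D (fun i => toColumn X (((f i).app j).app m z)) := by
  intro i i' h
  exact (Category.assoc _ _ _).symm.trans ((toColumn_w (hf i i' h) j m z).trans
    (Category.assoc _ _ _))

/-- The map into `X_W = X_{K_1} ×_{X_0} ⋯ ×_{X_0} X_{K_n}` induced by compatible maps into the
`X_{K_i}`. -/
noncomputable def wedgeLift {Z : SimplicialSpace.{u}} (f : ∀ i, Z ⟶ mapSpace X (D i).K)
    (hf : ∀ i j : Fin n, i.1 + 1 = j.1 →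
      f i ≫ restrict X (spineVertex (Fin.last (k i)) ≫ (D i).ι) =
        f j ≫ restrict X (spineVertex 0 ≫ (D j).ι)) : Z ⟶ mapSpace X G.W :=
  mapSpaceLift X
    (fun j m z => G.wedgeDesc _ (isGlued_toColumn hf j m z))
    (fun _ _ θ m z => G.wedge_hom_ext fun i =>
      (G.inc_wedgeDesc _ _ i).trans ((toColumn_map (f i) θ m z).trans
        (G.inc_wedgeDesc_assoc _ (isGlued_toColumn hf _ m z) i
          (((flipFunctor _ _ _).map (X.flip.map θ)).app m)).symm))
    (fun j m _ θ z => G.wedge_hom_ext fun i =>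
      (G.inc_wedgeDesc _ _ i).trans ((toColumn_obj_map (f i) j θ z).trans
        (G.inc_wedgeDesc_assoc _ (isGlued_toColumn hf j m z) i ((X.flip.obj j).flip.map θ)).symm))

lemma wedgeLift_inc {Z : SimplicialSpace.{u}} (f : ∀ i, Z ⟶ mapSpace X (D i).K)
    (hf : ∀ i j : Fin n, i.1 + 1 = j.1 →
      f i ≫ restrict X (spineVertex (Fin.last (k i)) ≫ (D i).ι) =
        f j ≫ restrict X (spineVertex 0 ≫ (D j).ι)) (i : Fin n) :
    G.wedgeLift f hf ≫ restrict X (G.inc i) = f i :=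
  mapSpace_hom_ext fun j m z => G.inc_wedgeDesc _ (isGlued_toColumn hf j m z) i

end Grafting

/-! Maps out of the spine are determined on its blocks. -/

lemma cut_comp_mkOfSucc {m : SimplexCategory} {n : ℕ} (f : m ⟶ ⦋n⦌) (a : Fin n)
    (h0 : ∀ i, a.1 ≤ (f.toOrderHom i).1) (h1 : ∀ i, (f.toOrderHom i).1 ≤ a.1 + 1) :
    cut f a.1 ≫ SimplexCategory.mkOfSucc a = f := by
  ext i : 3
  change (SimplexCategory.mkOfSucc a).toOrderHom (if (f.toOrderHom i).1 ≤ a.1 then (0 : Fin 2) else 1) =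
    f.toOrderHom i
  split_ifs with h
  · exact Fin.ext (le_antisymm (h0 i) h)
  · exact Fin.ext (le_antisymm (Nat.lt_of_not_le h) (h1 i))

lemma spine_hom_ext {Y : SSet.{u}} {n : ℕ} {f g : Sp.{u} n ⟶ Y}
    (he : ∀ i : Fin n, spineEdge i ≫ f = spineEdge i ≫ g)
    (hv : spineVertex (Fin.last n) ≫ f = spineVertex (Fin.last n) ≫ g) : f = g := by
  ext m s
  obtain ⟨φ, hφ⟩ : ∃ φ : m.unop ⟶ ⦋n⦌, SSet.stdSimplex.objEquiv s.1 = φ := ⟨_, rfl⟩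
  have hs : ∀ i j, ((SSet.stdSimplex.objEquiv s.1).toOrderHom j).1 ≤
    ((SSet.stdSimplex.objEquiv s.1).toOrderHom i).1 + 1 := s.2
  rw [hφ] at hs
  have h0 : ∀ i, (φ.toOrderHom 0).1 ≤ (φ.toOrderHom i).1 :=
    fun i => φ.toOrderHom.monotone (Fin.zero_le i)
  by_cases h : (φ.toOrderHom 0).1 < n
  · have h1 : s = (spineEdge ⟨_, h⟩).app m (SSet.stdSimplex.objEquiv.symm (cut φ (φ.toOrderHom 0).1)) := by
      apply Subtype.ext
      apply SSet.stdSimplex.objEquiv.injective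
      exact hφ.trans (cut_comp_mkOfSucc φ ⟨_, h⟩ h0 (hs 0)).symm
    rw [h1]
    exact ConcreteCategory.congr_hom (NatTrans.congr_app (he ⟨_, h⟩) m) _
  · have h1 : s = (spineVertex (Fin.last n)).app m
        (SSet.stdSimplex.objEquiv.symm (SimplexCategory.const m.unop ⦋0⦌ 0)) := by
      apply Subtype.ext
      apply SSet.stdSimplex.objEquiv.injective
      refine hφ.trans ?_
      change φ = SimplexCategory.const m.unop ⦋0⦌ 0 ≫ SimplexCategory.const ⦋0⦌ ⦋n⦌ (Fin.last n)
      ext i : 3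
      have := h0 i
      exact Fin.ext (le_antisymm (Nat.le_of_lt_succ (φ.toOrderHom i).2) (by
        change n ≤ _
        lia))
    rw [h1]
    exact ConcreteCategory.congr_hom (NatTrans.congr_app hv m) _

lemma spineEdge_spineSub {r : ℕ} (a k : ℕ) (h : a + k ≤ r) (i : Fin k) :
    spineEdge.{u} i ≫ spineSub a k h = spineEdge ⟨a + i, by lia⟩ := by
  rw [← cancel_mono (spine r).ι]
  refine (SSet.stdSimplex.map_comp (SimplexCategory.mkOfSucc i)
    (SimplexCategory.subinterval a k h)).symm.trans (congrArg SSet.stdSimplex.map ?_)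
  ext c : 3
  fin_cases c
  · exact Fin.ext (Nat.add_comm _ _)
  · exact Fin.ext ((Nat.add_comm _ _).trans (Nat.add_assoc _ _ _).symm)

lemma exists_block {n : ℕ} (k : Fin n → ℕ) (e : ℕ) :
    ∀ (l : ℕ) (hl : l < n), e < blockStart k ⟨l, hl⟩ + k ⟨l, hl⟩ →
      ∃ i, blockStart k i ≤ e ∧ e < blockStart k i + k i := by
  intro l
  induction l with
  | zero =>
    intro hl he
    exact ⟨⟨0, hl⟩, by rw [blockStart_zero]; exact Nat.zero_le _, he⟩
  | succ l ih =>
    intro hl he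
    by_cases h : blockStart k ⟨l + 1, hl⟩ ≤ e
    · exact ⟨_, h, he⟩
    · exact ih (by lia) (by
        rw [← blockStart_succ k ⟨l, by lia⟩ ⟨l + 1, hl⟩ rfl]
        lia)

lemma Grafting.spine_hom_ext {n : ℕ} {k : Fin n → ℕ} {D : ∀ i, CompCospan.{u} (k i)}
    {C₀ : CompCospan.{u} n} {r : ℕ} {C : CompCospan.{u} r} (G : Grafting D C₀ C) (hn : 0 < n)
    {Y : SSet.{u}} {f g : Sp.{u} r ⟶ Y}
    (h : ∀ i, spineSub _ _ (blockStart_add_le k i G.arity) ≫ f =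
      spineSub _ _ (blockStart_add_le k i G.arity) ≫ g) : f = g := by
  refine GraftedComp.spine_hom_ext ?_ ?_
  · intro e
    obtain ⟨i, hi1, hi2⟩ := exists_block k e.1 (n - 1) (by lia) (by
      rw [G.lastBlock hn]
      exact e.2)
    have : spineEdge.{u} e = spineEdge ⟨e.1 - blockStart k i, by lia⟩ ≫
        spineSub _ _ (blockStart_add_le k i G.arity) := by
      rw [spineEdge_spineSub]
      congr 1
      exact Fin.ext (by dsimp only; lia)
    rw [this, Category.assoc, Category.assoc, h]
  · have : spineVertex.{u} (Fin.last r) = spineVertex (Fin.last _) ≫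
        spineSub _ _ (blockStart_add_le k ⟨n - 1, by lia⟩ G.arity) := by
      rw [spineVertex_spineSub]
      congr 1
      exact Fin.ext (G.lastBlock hn).symm
    rw [this, Category.assoc, Category.assoc, h]

/-! ### The induced composition of a simplicial composition diagram -/

section Sections

variable {X : BisimplicialSpace.{u}}

/-- Sections of `ι^* : X_K ⟶ X_{Sp(n)}`. -/
abbrev SpineSection (X : BisimplicialSpace.{u}) {n : ℕ} (C : CompCospan.{u} n) :=
  {m : mapSpace X (Sp n) ⟶ mapSpace X C.K // m ≫ restrict X C.ι = 𝟙 _}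

/-- The section `μ_n : X_{Sp(n)} ⟶ X_{Δ[n]} = X_n`, for a cospan isomorphic to
`Sp(n) ⟶ Δ[n] ⟵ Δ[1]`. -/
def simplexSection (μ : HorizontalCompositions X) {n : ℕ} {C : CompCospan.{u} n}
    (e : (CompCospan.simplex n).K ≅ C.K) (hι : (CompCospan.simplex n).ι ≫ e.hom = C.ι) :
    SpineSection X C :=
  ⟨μ.μ n ≫ (mapSpaceSimplexIso X n).inv ≫ restrict X e.inv, by
    have h : C.ι ≫ e.inv = (spine n).ι := by
      rw [← hι, Category.assoc, e.hom_inv_id, Category.comp_id]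
      rfl
    have h' : restrict X e.inv ≫ restrict X C.ι = restrict X (spine n).ι := congrArg (restrict X) h
    refine Eq.trans ?_ (μ.section_ n)
    exact congrArg (fun t => μ.μ n ≫ (mapSpaceSimplexIso X n).inv ≫ t) h'⟩

namespace Grafting

variable {d : ℕ} {k : Fin d → ℕ} {D : ∀ i, CompCospan.{u} (k i)} {C₀ : CompCospan.{u} d}
  {r : ℕ} {C : CompCospan.{u} r}

/-- The map `X_{Sp(r)} ⟶ X_{K_i}` given by the section `X_{Sp(k_i)} ⟶ X_{K_i}` on the `i`-th
block of the spine. -/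
def blockSection (G : Grafting D C₀ C) (s : ∀ i, SpineSection X (D i)) (i : Fin d) :
    mapSpace X (Sp r) ⟶ mapSpace X (D i).K :=
  restrict X (spineSub _ _ (blockStart_add_le k i G.arity)) ≫ (s i).1

lemma blockSection_ι (G : Grafting D C₀ C) (s : ∀ i, SpineSection X (D i)) (i : Fin d)
    {L : SSet.{u}} (v : L ⟶ Sp (k i)) :
    G.blockSection s i ≫ restrict X (v ≫ (D i).ι) =
      restrict X (v ≫ spineSub _ _ (blockStart_add_le k i G.arity)) := by
  rw [restrict_comp, blockSection, Category.assoc, ← Category.assoc (s i).1, (s i).2,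
    Category.id_comp, restrict_comp]

/-- The map `s_1 ×_{X_0} ⋯ ×_{X_0} s_d : X_{Sp(r)} ⟶ X_{K_1} ×_{X_0} ⋯ ×_{X_0} X_{K_d}` induced by
sections `s_i : X_{Sp(k_i)} ⟶ X_{K_i}`. -/
noncomputable def wedgeSection (G : Grafting D C₀ C) (s : ∀ i, SpineSection X (D i)) :
    mapSpace X (Sp r) ⟶ mapSpace X G.W :=
  G.wedgeLift (G.blockSection s) (by
    intro i j hij
    rw [blockSection_ι, blockSection_ι, spineVertex_spineSub, spineVertex_spineSub]
    congr 2
    refine Fin.ext ?_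
    have := blockStart_succ k i j hij
    simp only [Fin.val_last, Fin.val_zero]
    lia)

lemma wedgeSection_ιW (G : Grafting D C₀ C) (hd : 0 < d) (s : ∀ i, SpineSection X (D i)) :
    G.wedgeSection s ≫ restrict X G.ιW = 𝟙 _ := by
  refine mapSpace_hom_ext fun j m z => G.spine_hom_ext hd fun i => ?_
  have h : (G.wedgeSection s ≫ restrict X G.ιW) ≫
      restrict X (spineSub _ _ (blockStart_add_le k i G.arity)) =
        𝟙 _ ≫ restrict X (spineSub _ _ (blockStart_add_le k i G.arity)) := by
    rw [Category.assoc, ← restrict_comp, G.sub_ιW, restrict_comp, ← Category.assoc, wedgeSection,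
      wedgeLift_inc, blockSection, Category.assoc, (s i).2, Category.comp_id, Category.id_comp]
  exact toColumn_w h j m z

end Grafting

/-- The section `X_{Sp(r)} ⟶ X_K = (X_{K_1} ×_{X_0} ⋯ ×_{X_0} X_{K_d}) ×_{X_{Sp(d)}} X_d` induced by
`s_1 ×_{X_0} ⋯ ×_{X_0} s_d` and `μ_d ∘ (τ_1^* ×_{X_0} ⋯ ×_{X_0} τ_d^*) ∘ (s_1 ×_{X_0} ⋯ ×_{X_0} s_d)`,
for sections `s_i : X_{Sp(k_i)} ⟶ X_{K_i}`. -/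
noncomputable def graftSection (μ : HorizontalCompositions X) {d : ℕ} (hd : 1 < d)
    {k : Fin d → ℕ} {D : ∀ i, CompCospan.{u} (k i)} (s : ∀ i, SpineSection X (D i)) {r : ℕ}
    {C : CompCospan.{u} r} (G : Grafting D (CompCospan.simplex d) C) : SpineSection X C :=
  have w : G.wedgeSection s ≫ restrict X G.τW =
      (G.wedgeSection s ≫ restrict X G.τW ≫ μ.μ d ≫ (mapSpaceSimplexIso X d).inv) ≫
        restrict X (CompCospan.simplex d).ι := by
    have h : μ.μ d ≫ (mapSpaceSimplexIso X d).inv ≫ restrict X (CompCospan.simplex d).ι = 𝟙 _ :=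
      μ.section_ d
    rw [Category.assoc, Category.assoc, Category.assoc, h, Category.comp_id]
  ⟨pushoutLift G.isPushout (G.wedgeSection s)
      (G.wedgeSection s ≫ restrict X G.τW ≫ μ.μ d ≫ (mapSpaceSimplexIso X d).inv) w, by
    have h := pushoutLift_inl G.isPushout (G.wedgeSection s) _ w
    rw [G.ι_eq, restrict_comp]
    exact (congrArg (fun t => t ≫ restrict X G.ιW) h).trans (G.wedgeSection_ιW (by lia) s)⟩

end Sections

end Induced

section Operations

variable {X : BisimplicialSpace.{u}}

/-- The induced composition `μ_K : X_{Sp(n)} ⟶ X_K` of a simplicial composition diagram, a section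
of `ι^* : X_K ⟶ X_{Sp(n)}`. -/
noncomputable def SCD.inducedComp (μ : HorizontalCompositions X) {n : ℕ} {C : CompCospan.{u} n} :
    SCD C → SpineSection X C
  | .simplex e hι _ => simplexSection μ e hι
  | .graft hd S G => graftSection μ hd (fun i => (S i).inducedComp μ) G

/-- The composition operation
`∘_K^{x_0, …, x_n} : ∏_{i=1}^n X(x_{i-1}, x_i) ⟶ X_{Sp(n)}^{x_0,x_n} ⟶ X_K^{x_0,x_n} ⟶ X(x_0, x_n)`
of a simplicial composition diagram. -/
noncomputable def SCD.comp (μ : HorizontalCompositions X) {n : ℕ} {C : CompCospan.{u} n}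
    (S : SCD C) (x : Fin (n + 1) → Ob X) :
    homProduct X x ⟶ homSpace X (x 0) (x (Fin.last n)) :=
  homProductInclusion X x ≫
    fibreMap (s' := evalVertex X (spineVertex 0 ≫ C.ι))
      (t' := evalVertex X (spineVertex (Fin.last n) ≫ C.ι)) (S.inducedComp μ).1
      (by
        have h := (S.inducedComp μ).2 =≫ evalVertex X (spineVertex (0 : Fin (n + 1)))
        rwa [Category.assoc, Category.id_comp] at h)
      (by
        have h := (S.inducedComp μ).2 =≫ evalVertex X (spineVertex (Fin.last n))
        rwa [Category.assoc, Category.id_comp] at h)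
      (x 0) (x (Fin.last n)) ≫
    fibreMap (evalEdge X C.τ)
      (by rw [evalEdge_src, S.endpointsAgree.1]) (by rw [evalEdge_tgt, S.endpointsAgree.2])
      (x 0) (x (Fin.last n))

end Operations

/-! ### Nested lists of objects -/

section Lists

variable {X : BisimplicialSpace.{u}} {n : ℕ} {k : Fin n → ℕ}

/-- Nested lists `((x^1_0, …, x^1_{k_1}), …, (x^n_0, …, x^n_{k_n}))` of objects such that
`x^i_{k_i} = x^{i+1}_0` for `i < n`. -/
def IsNestedList (y : ∀ i, Fin (k i + 1) → Ob X) : Prop :=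
  ∀ i j : Fin n, i.1 + 1 = j.1 → y i (Fin.last (k i)) = y j 0

/-- `(x_0, …, x_r)` is the flattened version of a nested list, with `r = k_1 + ⋯ + k_n`: the
sublist `(x_a, …, x_{a + k_i})` with `a = k_1 + ⋯ + k_{i-1}` is `(x^i_0, …, x^i_{k_i})`. -/
def IsFlattening {r : ℕ} (hr : r = ∑ i, k i) (y : ∀ i, Fin (k i + 1) → Ob X)
    (x : Fin (r + 1) → Ob X) : Prop :=
  ∀ (i : Fin n) (j : Fin (k i + 1)),
    x ⟨blockStart k i + j, by have := blockStart_add_le k i hr; lia⟩ = y i j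

/-- The list `(x^1_0, x^2_0, …, x^n_0, x^n_{k_n})`. -/
def outerList (hn : 1 ≤ n) (y : ∀ i, Fin (k i + 1) → Ob X) (l : Fin (n + 1)) : Ob X :=
  if h : l.1 < n then y ⟨l.1, h⟩ 0 else y ⟨n - 1, by lia⟩ (Fin.last _)

lemma outerList_castSucc (hn : 1 ≤ n) (y : ∀ i, Fin (k i + 1) → Ob X) (i : Fin n) :
    outerList hn y i.castSucc = y i 0 :=
  dif_pos i.2

lemma outerList_succ (hn : 1 ≤ n) {y : ∀ i, Fin (k i + 1) → Ob X} (hy : IsNestedList y)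
    (i : Fin n) : outerList hn y i.succ = y i (Fin.last (k i)) := by
  by_cases h : i.1 + 1 < n
  · exact (dif_pos h).trans (hy i ⟨i.1 + 1, h⟩ rfl).symm
  · have hi : i = ⟨n - 1, by lia⟩ := Fin.ext (by dsimp only; lia)
    refine (dif_neg h).trans ?_
    subst hi
    rfl

lemma outerList_zero (hn : 1 ≤ n) {r : ℕ} {hr : r = ∑ i, k i} {y : ∀ i, Fin (k i + 1) → Ob X}
    {x : Fin (r + 1) → Ob X} (hx : IsFlattening hr y x) : x 0 = outerList hn y 0 := by
  refine Eq.trans ?_ (dif_pos hn).symm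
  rw [← hx]
  congr 1
  exact Fin.ext (blockStart_zero k hn).symm

lemma outerList_last (hn : 1 ≤ n) {r : ℕ} {hr : r = ∑ i, k i} {y : ∀ i, Fin (k i + 1) → Ob X}
    {x : Fin (r + 1) → Ob X} (hx : IsFlattening hr y x) :
    x (Fin.last r) = outerList hn y (Fin.last n) := by
  refine Eq.trans ?_ (dif_neg (lt_irrefl n)).symm
  rw [← hx]
  congr 1
  exact Fin.ext ((blockStart_last k hn).trans hr.symm).symm

/-- The identification `X(a, b) = X(a', b')` for `a = a'` and `b = b'`. -/
noncomputable def homSpaceCongr {a a' b b' : Ob X} (ha : a = a') (hb : b = b') :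
    homSpace X a b ⟶ homSpace X a' b' :=
  eqToHom (by rw [ha, hb])

/-- The isomorphism `∏_{l=1}^r X(x_{l-1}, x_l) ≅ ∏_{i=1}^n ∏_{j=1}^{k_i} X(x^i_{j-1}, x^i_j)` for the
flattened version `(x_0, …, x_r)` of a nested list. -/
noncomputable def regroup {r : ℕ} {hr : r = ∑ i, k i} {y : ∀ i, Fin (k i + 1) → Ob X}
    {x : Fin (r + 1) → Ob X} (hx : IsFlattening hr y x) :
    homProduct X x ⟶ ∏ᶜ fun i => homProduct X (y i) :=
  Pi.lift fun i => Pi.lift fun j =>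
    Pi.π (fun l : Fin r => homSpace X (x l.castSucc) (x l.succ))
        ⟨blockStart k i + j, by have := blockStart_add_le k i hr; lia⟩ ≫
      homSpaceCongr (hx i j.castSucc) (hx i j.succ)

end Lists

end GraftedComp

open GraftedComp

namespace GraftedComp

open Simplicial

/-! ### Pushouts of simplicial sets along monomorphisms -/

section Pushouts

variable {I A B P : SSet.{u}} {a : I ⟶ A} {b : I ⟶ B} {inl : A ⟶ P} {inr : B ⟶ P}

/-! The two claims have independent proofs.

The composition formula must hold for every inductive construction of the grafting `K`, so `μ_K` is
first characterised without reference to a construction. For fixed `j`, `m`, an element of `X_K` is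
a map `ψ` from `K` to the simplicial set `X_{•,j,m}`. Call `ψ` compatible if on each maximal
nondegenerate simplex of dimension `d ≥ 2` its value is `μ_d` of its restriction to the spine of
that simplex. Then `μ_K(φ)` is the unique compatible map extending `φ` along `ι`: existence is
`SCD.isCompatible_extend`, uniqueness is `SCD.hom_ext_of_isCompatible`.

Gluing along spines only identifies degeneracies of vertices and edges. Hence the maximal simplices
of dimension at least `2` of a grafting are exactly those of its pieces (`isCell_inl`, `isCell_inr`,
`Grafting.isCell_inc`, `Grafting.exists_of_isCell`). So compatibility restricts to the pieces, and
uniqueness there identifies the restrictions of `μ_K` with `μ_{K_i}` and `μ_{K_0}`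
(`Grafting.inc_extend`, `Grafting.inr_extend`). Projecting to `X_1` gives the formula
(`Grafting.comp_eq`). The argument needs the spine of `K_0` to embed, which follows from a map from
`K_0` to `Δ[n]` restricting to the standard inclusion on the spine (`SCD.exists_toSimplex`).

That `K` is again a simplicial composition diagram is proved by induction on `K_0`, by associativity
of grafting. For this a grafting is rewritten as a gluing of each edge `τ_i` directly to the `i`-th
spine edge of `K_0` (`EdgeGrafting`). This avoids the wedge and also makes sense for arity `0`,
which occurs among the inner pieces. Associativity is then a comparison of universal properties
(`EdgeGrafting.assoc`), and the cases where `K_0` is `Δ[0]` or `Δ[1]` change nothing up to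
isomorphism. -/

lemma isPushout_app (h : IsPushout a b inl inr) (m : SimplexCategoryᵒᵖ) :
    IsPushout (a.app m) (b.app m) (inl.app m) (inr.app m) :=
  h.map ((evaluation _ _).obj m)

lemma app_injective {A B : SSet.{u}} (f : A ⟶ B) [Mono f] (m : SimplexCategoryᵒᵖ) :
    Function.Injective (f.app m) :=
  (mono_iff_injective _).1 inferInstance

lemma exists_inl_or_inr (h : IsPushout a b inl inr) {m : SimplexCategoryᵒᵖ} (p : P.obj m) :
    (∃ x, inl.app m x = p) ∨ ∃ y, inr.app m y = p :=
  Types.eq_or_eq_of_isPushout (isPushout_app h m) p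

lemma pushout_inl_injective (h : IsPushout a b inl inr) [Mono b] (m : SimplexCategoryᵒᵖ) :
    Function.Injective (inl.app m) :=
  Types.pushoutCocone_inr_injective_of_isColimit (isPushout_app h m).flip.isColimit
    (app_injective b m)

lemma exists_of_inl_eq_inr (h : IsPushout a b inl inr) [Mono b] {m : SimplexCategoryᵒᵖ}
    {x : A.obj m} {y : B.obj m} (hxy : inl.app m x = inr.app m y) :
    ∃ s, a.app m s = x ∧ b.app m s = y := by
  obtain ⟨s, h1, h2⟩ := (Types.pushoutCocone_inl_eq_inr_iff_of_isColimit
    (isPushout_app h m).flip.isColimit (app_injective b m) y x).1 hxy.symm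
  exact ⟨s, h2, h1⟩

/-- No injectivity of `a` is assumed: in the application `a` is `τW`, which collapses an edge when
some `K_i` is `Δ[0]`. So `inr` is injective only away from the glued part. -/
lemma inr_eq_inr (h : IsPushout a b inl inr) {m : SimplexCategoryᵒᵖ}
    {x y : B.obj m} (hxy : inr.app m x = inr.app m y) (hx : x ∉ Set.range (b.app m)) : x = y := by
  classical
  -- This test map sends the glued part to `none`, as the constant map on `A` does, and separates
  -- all other points of `B`.
  let g : B.obj m ⟶ Option (B.obj m) := ↾fun z => if z ∈ Set.range (b.app m) then none else some z
  have w : a.app m ≫ (↾fun _ => none : A.obj m ⟶ Option (B.obj m)) = b.app m ≫ g := by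
    refine ConcreteCategory.hom_ext _ _ fun s => ?_
    exact (if_pos (Set.mem_range_self s)).symm
  have h1 : g x = g y := by
    rw [← (isPushout_app h m).inr_desc _ g w]
    exact congrArg ((isPushout_app h m).desc _ g w) hxy
  change (if _ then _ else _) = (if _ then _ else _) at h1
  rw [if_neg hx] at h1
  split_ifs at h1
  exact Option.some.inj h1

end Pushouts

/-! ### Maximal nondegenerate simplices -/

/-- The maximal nondegenerate simplices `σ`: every simplex which has `σ` as a face of some
dimension is a degeneracy of `σ`. -/
def IsCell (K : SSet.{u}) {d : ℕ} (σ : K.obj (op ⦋d⦌)) : Prop :=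
  ∀ (m : ℕ) (ρ : K.obj (op ⦋m⦌)) (α : ⦋d⦌ ⟶ ⦋m⦌), K.map α.op ρ = σ →
    ∃ β : ⦋m⦌ ⟶ ⦋d⦌, α ≫ β = 𝟙 _ ∧ K.map β.op σ = ρ

/-- The witness `β` splits `α`. In particular a cell is not a degeneracy of anything of smaller
dimension. -/
lemma IsCell.le {K : SSet.{u}} {d : ℕ} {σ : K.obj (op ⦋d⦌)} (h : IsCell K σ) {m : ℕ}
    {ρ : K.obj (op ⦋m⦌)} {α : ⦋d⦌ ⟶ ⦋m⦌} (hα : K.map α.op ρ = σ) : d ≤ m := by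
  obtain ⟨β, h1, -⟩ := h m ρ α hα
  have : IsSplitMono α := ⟨⟨β, h1⟩⟩
  exact SimplexCategory.len_le_of_mono α

/-- The converse fails in general, since a cell of `K` can become a proper face in `L`; excluding
this for graftings needs the dimension bound on spines. -/
lemma IsCell.of_injective {K L : SSet.{u}} {f : K ⟶ L} (hf : ∀ m, Function.Injective (f.app m))
    {d : ℕ} {σ : K.obj (op ⦋d⦌)} (h : IsCell L (f.app _ σ)) : IsCell K σ := by
  intro m ρ α hα
  obtain ⟨β, h1, h2⟩ := h m (f.app _ ρ) α (by
    rw [← hα]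
    exact (ConcreteCategory.congr_hom (f.naturality α.op) ρ).symm)
  exact ⟨β, h1, hf _ ((ConcreteCategory.congr_hom (f.naturality β.op) σ).trans h2)⟩

/-- Simplices of spines are degeneracies of vertices or edges. -/
lemma exists_spine_eq {n d : ℕ} (s : (Sp.{u} n).obj (op ⦋d⦌)) :
    ∃ (e : ℕ) (_ : e ≤ 1) (γ : ⦋d⦌ ⟶ ⦋e⦌) (t : (Sp.{u} n).obj (op ⦋e⦌)),
      (Sp.{u} n).map γ.op t = s := by
  obtain ⟨φ, hφ⟩ : ∃ φ : ⦋d⦌ ⟶ ⦋n⦌, SSet.stdSimplex.objEquiv s.1 = φ := ⟨_, rfl⟩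
  have hs : ∀ i j, ((SSet.stdSimplex.objEquiv s.1).toOrderHom j).1 ≤
    ((SSet.stdSimplex.objEquiv s.1).toOrderHom i).1 + 1 := s.2
  rw [hφ] at hs
  have h0 : ∀ i, (φ.toOrderHom 0).1 ≤ (φ.toOrderHom i).1 :=
    fun i => φ.toOrderHom.monotone (Fin.zero_le i)
  by_cases h : (φ.toOrderHom 0).1 < n
  · refine ⟨1, le_rfl, cut φ (φ.toOrderHom 0).1,
      (spineEdge ⟨_, h⟩).app _ (SSet.stdSimplex.objEquiv.symm (𝟙 _)), ?_⟩
    apply Subtype.ext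
    apply SSet.stdSimplex.objEquiv.injective
    exact (cut_comp_mkOfSucc φ ⟨_, h⟩ h0 (hs 0)).trans hφ.symm
  · refine ⟨0, Nat.zero_le _, SimplexCategory.const ⦋d⦌ ⦋0⦌ 0,
      (spineVertex (Fin.last n)).app _ (SSet.stdSimplex.objEquiv.symm (𝟙 _)), ?_⟩
    apply Subtype.ext
    apply SSet.stdSimplex.objEquiv.injective
    refine Eq.trans ?_ hφ.symm
    change SimplexCategory.const ⦋d⦌ ⦋0⦌ 0 ≫ SimplexCategory.const ⦋0⦌ ⦋n⦌ (Fin.last n) = φ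
    ext i : 3
    have := h0 i
    exact Fin.ext (le_antisymm (by
      change n ≤ _
      lia) (Nat.le_of_lt_succ (φ.toOrderHom i).2))

/-- Cells of dimension at least `2` are therefore untouched by gluing along spines. -/
lemma IsCell.ne_spine {K : SSet.{u}} {d : ℕ} {σ : K.obj (op ⦋d⦌)} (h : IsCell K σ) (hd : 2 ≤ d)
    {n : ℕ} (f : Sp.{u} n ⟶ K) (s : (Sp.{u} n).obj (op ⦋d⦌)) : f.app _ s ≠ σ := by
  rintro rfl
  obtain ⟨e, he, γ, t, rfl⟩ := exists_spine_eq s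
  have := h.le (ConcreteCategory.congr_hom (f.naturality γ.op) t).symm
  lia

lemma IsCell.ne_vertex {K : SSet.{u}} {d : ℕ} {σ : K.obj (op ⦋d⦌)} (h : IsCell K σ) (hd : 2 ≤ d)
    (f : Δ[0] ⟶ K) (s : (Δ[0] : SSet.{u}).obj (op ⦋d⦌)) : f.app _ s ≠ σ := by
  rintro rfl
  have : s = (Δ[0] : SSet.{u}).map (SimplexCategory.const ⦋d⦌ ⦋0⦌ 0).op
      (SSet.stdSimplex.objEquiv.symm (𝟙 _)) := by
    apply SSet.stdSimplex.objEquiv.injective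
    exact Subsingleton.elim _ _
  rw [this] at h
  have := h.le (ConcreteCategory.congr_hom (f.naturality (SimplexCategory.const ⦋d⦌ ⦋0⦌ 0).op)
    _).symm
  lia

/-- The nondegenerate simplex of top dimension of `Δ[n]`. -/
def topSimplex (n : ℕ) : (Δ[n] : SSet.{u}).obj (op ⦋n⦌) := SSet.stdSimplex.objEquiv.symm (𝟙 _)

/-- The retraction `β` is `ρ` itself, read as a map in the simplex category. -/
lemma isCell_topSimplex (n : ℕ) : IsCell Δ[n] (topSimplex.{u} n) := by
  intro m ρ α hα
  refine ⟨SSet.stdSimplex.objEquiv ρ, ?_, ?_⟩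
  · exact congrArg SSet.stdSimplex.objEquiv hα
  · apply SSet.stdSimplex.objEquiv.injective
    exact Category.comp_id (SSet.stdSimplex.objEquiv ρ)

/-- Every simplex of `Δ[n]` is pulled back from the top one. Maximality makes the pulling-back map
invertible, and the simplex category has no isomorphisms but identities. -/
lemma IsCell.eq_topSimplex {n d : ℕ} {σ : (Δ[n] : SSet.{u}).obj (op ⦋d⦌)} (h : IsCell Δ[n] σ) :
    ∃ e : d = n, σ = e ▸ topSimplex.{u} n := by
  obtain ⟨β, h1, h2⟩ := h n (topSimplex n) (SSet.stdSimplex.objEquiv σ) (by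
    apply SSet.stdSimplex.objEquiv.injective
    exact Category.comp_id (SSet.stdSimplex.objEquiv σ))
  have h2 : β ≫ SSet.stdSimplex.objEquiv σ = 𝟙 ⦋n⦌ := congrArg SSet.stdSimplex.objEquiv h2
  have m1 : IsSplitMono (SSet.stdSimplex.objEquiv σ) := ⟨⟨β, h1⟩⟩
  have m2 : IsSplitMono β := ⟨⟨_, h2⟩⟩
  obtain rfl : d = n := le_antisymm
    (SimplexCategory.len_le_of_mono (SSet.stdSimplex.objEquiv σ)) (SimplexCategory.len_le_of_mono β)
  refine ⟨rfl, ?_⟩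
  apply SSet.stdSimplex.objEquiv.injective
  exact SimplexCategory.eq_id_of_mono _

/-! ### Maximal nondegenerate simplices of graftings -/

section Pushouts

variable {A B P : SSet.{u}} {n : ℕ} {a : Sp.{u} n ⟶ A} {b : Sp.{u} n ⟶ B} {inl : A ⟶ P}
  {inr : B ⟶ P} {d : ℕ}

/-- A simplex `ρ` over `inl σ` comes from `A`, where maximality of `σ` applies, or from `B`. In the
latter case `σ` would lie in the image of the spine, against its dimension. -/
lemma isCell_inl [Mono b] (h : IsPushout a b inl inr) (hd : 2 ≤ d) {σ : A.obj (op ⦋d⦌)}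
    (hσ : IsCell A σ) : IsCell P (inl.app _ σ) := by
  intro m ρ α hα
  obtain ⟨ρ, rfl⟩ | ⟨ρ, rfl⟩ := exists_inl_or_inr h ρ
  · obtain ⟨β, h1, h2⟩ := hσ m ρ α (pushout_inl_injective h _
      ((ConcreteCategory.congr_hom (inl.naturality α.op) ρ).trans hα))
    refine ⟨β, h1, ?_⟩
    rw [← h2]
    exact (ConcreteCategory.congr_hom (inl.naturality β.op) σ).symm
  · have h1 : inr.app _ (B.map α.op ρ) = inl.app _ σ :=
      (ConcreteCategory.congr_hom (inr.naturality α.op) ρ).trans hα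
    obtain ⟨s, h2, -⟩ := exists_of_inl_eq_inr h h1.symm
    exact absurd h2 (hσ.ne_spine hd a s)

lemma isCell_inr [Mono b] (h : IsPushout a b inl inr) (hd : 2 ≤ d) {σ : B.obj (op ⦋d⦌)}
    (hσ : IsCell B σ) : IsCell P (inr.app _ σ) := by
  have hr : σ ∉ Set.range (b.app _) := fun ⟨s, hs⟩ => hσ.ne_spine hd b s hs
  intro m ρ α hα
  obtain ⟨ρ, rfl⟩ | ⟨ρ, rfl⟩ := exists_inl_or_inr h ρ
  · have h1 : inl.app _ (A.map α.op ρ) = inr.app _ σ :=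
      (ConcreteCategory.congr_hom (inl.naturality α.op) ρ).trans hα
    obtain ⟨s, -, h2⟩ := exists_of_inl_eq_inr h h1
    exact absurd ⟨s, h2⟩ hr
  · have h1 : inr.app _ (B.map α.op ρ) = inr.app _ σ :=
      (ConcreteCategory.congr_hom (inr.naturality α.op) ρ).trans hα
    obtain ⟨β, h2, h3⟩ := hσ m ρ α (inr_eq_inr h h1.symm hr).symm
    refine ⟨β, h2, ?_⟩
    rw [← h3]
    exact (ConcreteCategory.congr_hom (inr.naturality β.op) σ).symm

lemma IsCell.of_inr (h : IsPushout a b inl inr) {σ : B.obj (op ⦋d⦌)}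
    (hσ : IsCell P (inr.app _ σ)) (hr : σ ∉ Set.range (b.app _)) : IsCell B σ := by
  intro m ρ α hα
  obtain ⟨β, h1, h2⟩ := hσ m (inr.app _ ρ) α (by
    rw [← hα]
    exact (ConcreteCategory.congr_hom (inr.naturality α.op) ρ).symm)
  refine ⟨β, h1, (inr_eq_inr h (?_ : inr.app _ ρ = inr.app _ (B.map β.op σ)) ?_).symm⟩
  · rw [← h2]
    exact (ConcreteCategory.congr_hom (inr.naturality β.op) σ).symm
  -- If `ρ` came from the spine, so would its pullback `σ`.
  · rintro ⟨s, rfl⟩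
    exact hr ⟨(Sp n).map α.op s, by
      rw [← hα]
      exact ConcreteCategory.congr_hom (b.naturality α.op) s⟩

/-- The maximal nondegenerate simplices of dimension at least `2` of a pushout along a map from a
spine come from the two components. -/
lemma IsCell.exists_of_isPushout [Mono b] (h : IsPushout a b inl inr) (hd : 2 ≤ d) {σ : P.obj (op ⦋d⦌)}
    (hσ : IsCell P σ) : (∃ v, inl.app _ v = σ ∧ IsCell A v) ∨ ∃ v, inr.app _ v = σ ∧ IsCell B v := by
  obtain ⟨v, rfl⟩ | ⟨v, rfl⟩ := exists_inl_or_inr h σ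
  · exact .inl ⟨v, rfl, hσ.of_injective (pushout_inl_injective h)⟩
  · refine .inr ⟨v, rfl, hσ.of_inr h ?_⟩
    rintro ⟨s, rfl⟩
    exact hσ.ne_spine hd (b ≫ inr) s rfl

end Pushouts

namespace Grafting

variable {n : ℕ} {k : Fin n → ℕ} {D : ∀ i, CompCospan.{u} (k i)} {C₀ : CompCospan.{u} n}
  {r : ℕ} {C : CompCospan.{u} r} (G : Grafting D C₀ C)

/-- The map from `K_j` to `K_i` which is the identity for `j = i` and otherwise the constant map to
the first or the last spine vertex. -/
def collapse (i j : Fin n) : (D j).K ⟶ (D i).K :=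
  if h : j = i then eqToHom (by rw [h])
  else SSet.stdSimplex.isTerminalObj₀.from _ ≫ spineVertex (if j < i then 0 else Fin.last _) ≫ (D i).ι

lemma collapse_self (i : Fin n) : collapse (D := D) i i = 𝟙 _ :=
  dif_pos rfl

lemma comp_collapse {i j : Fin n} (h : j ≠ i) (v : Δ[0] ⟶ (D j).K) :
    v ≫ collapse i j = spineVertex (if j < i then 0 else Fin.last _) ≫ (D i).ι := by
  rw [collapse, dif_neg h, ← Category.assoc,
    SSet.stdSimplex.isTerminalObj₀.hom_ext (v ≫ SSet.stdSimplex.isTerminalObj₀.from _) (𝟙 _),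
    Category.id_comp]

/-- Components before `i` go to the first spine vertex and those after it to the last one. A
junction away from `K_i` has both sides on the same constant, and a junction with `K_i` has the
matching end vertex. -/
lemma isGlued_collapse (i : Fin n) : IsGlued D (collapse i) := by
  intro j j' hj
  rw [← Category.assoc, ← Category.assoc]
  obtain rfl | h := eq_or_ne j i
  · refine (congrArg (fun t => (spineVertex _ ≫ (D j).ι) ≫ t) (collapse_self j)).trans ?_
    rw [comp_collapse (by lia), Category.comp_id, if_neg (by lia)]
  · obtain rfl | h' := eq_or_ne j' i
    · refine Eq.trans ?_
        (congrArg (fun t => (spineVertex _ ≫ (D j').ι) ≫ t) (collapse_self j')).symm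
      rw [comp_collapse h, Category.comp_id, if_pos (by lia)]
    · rw [comp_collapse h, comp_collapse h']
      congr 2
      exact if_congr (by lia) rfl rfl

/-- The retraction of the wedge onto one of its components. -/
noncomputable def wedgeRetraction (i : Fin n) : G.W ⟶ (D i).K :=
  G.wedgeDesc (collapse i) (isGlued_collapse i)

lemma inc_wedgeRetraction (i : Fin n) : G.inc i ≫ G.wedgeRetraction i = 𝟙 _ :=
  (G.inc_wedgeDesc _ _ i).trans (dif_pos rfl)

lemma inc_wedgeRetraction_of_ne {i j : Fin n} (h : j ≠ i) :
    ∃ v, G.inc j ≫ G.wedgeRetraction i = SSet.stdSimplex.isTerminalObj₀.from _ ≫ v :=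
  ⟨_, (G.inc_wedgeDesc _ _ j).trans (dif_neg h)⟩

lemma inc_injective (i : Fin n) (m : SimplexCategoryᵒᵖ) : Function.Injective ((G.inc i).app m) := by
  have : IsSplitMono (G.inc i) := ⟨⟨_, G.inc_wedgeRetraction i⟩⟩
  exact app_injective _ m

/-- The wedge is known only by its universal property, so the identity is factored through the union
`R` of the images of the components. -/
lemma exists_inc (m : SimplexCategoryᵒᵖ) (w : G.W.obj m) : ∃ i v, (G.inc i).app m v = w := by
  let R : G.W.Subcomplex := ⨆ i, SSet.Subcomplex.range (G.inc i)
  let f (i) : (D i).K ⟶ R.toSSet := SSet.Subcomplex.lift (G.inc i) (le_iSup (fun i =>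
    SSet.Subcomplex.range (G.inc i)) i)
  have hf : IsGlued D f := by
    intro i j hij
    rw [← cancel_mono R.ι]
    exact G.glued i j hij
  have h : G.wedgeDesc f hf ≫ R.ι = 𝟙 _ := G.wedge_hom_ext fun i => by
    rw [inc_wedgeDesc_assoc, Category.comp_id]
    rfl
  have h1 := ((G.wedgeDesc f hf).app m w).2
  have h2 : ((G.wedgeDesc f hf).app m w).1 = w := by
    have h3 : (G.wedgeDesc f hf ≫ R.ι).app m w = (𝟙 G.W :).app m w := by rw [h]
    exact h3
  rw [h2] at h1
  simpa [R] using h1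

/-- If `ρ` lies in another component, the retraction onto `K_i` sends it through `Δ[0]` but fixes
`σ`, which is impossible for a cell of dimension at least `2`. -/
lemma isCell_inc (i : Fin n) {d : ℕ} (hd : 2 ≤ d) {σ : (D i).K.obj (op ⦋d⦌)}
    (hσ : IsCell (D i).K σ) : IsCell G.W ((G.inc i).app _ σ) := by
  intro m ρ α hα
  obtain ⟨j, ρ, rfl⟩ := G.exists_inc _ ρ
  have h1 : (G.inc j).app _ ((D j).K.map α.op ρ) = (G.inc i).app _ σ :=
    (ConcreteCategory.congr_hom ((G.inc j).naturality α.op) ρ).trans hα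
  obtain rfl | hij := eq_or_ne j i
  · obtain ⟨β, h2, h3⟩ := hσ m ρ α (G.inc_injective _ _ h1)
    refine ⟨β, h2, ?_⟩
    rw [← h3]
    exact (ConcreteCategory.congr_hom ((G.inc j).naturality β.op) σ).symm
  · obtain ⟨v, hv⟩ := G.inc_wedgeRetraction_of_ne hij
    refine absurd ?_ (hσ.ne_vertex hd v ((SSet.stdSimplex.isTerminalObj₀.from _).app _
      ((D j).K.map α.op ρ)))
    refine (ConcreteCategory.congr_hom (NatTrans.congr_app hv _) _).symm.trans ?_
    refine (congrArg ((G.wedgeRetraction i).app _) h1).trans ?_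
    exact ConcreteCategory.congr_hom (NatTrans.congr_app (G.inc_wedgeRetraction i) _) σ

/-- The maximal nondegenerate simplices of dimension at least `2` of a grafting come from its
components. -/
lemma exists_of_isCell [Mono C₀.ι] {d : ℕ} (hd : 2 ≤ d) {σ : C.K.obj (op ⦋d⦌)}
    (hσ : IsCell C.K σ) :
    (∃ i v, G.inl.app _ ((G.inc i).app _ v) = σ ∧ IsCell (D i).K v) ∨
      ∃ v, G.inr.app _ v = σ ∧ IsCell C₀.K v := by
  obtain ⟨w, h1, hw⟩ | h := hσ.exists_of_isPushout G.isPushout hd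
  · obtain ⟨i, v, rfl⟩ := G.exists_inc _ w
    exact .inl ⟨i, v, h1, hw.of_injective (G.inc_injective i)⟩
  · exact .inr h

end Grafting

/-! ### The spine of a simplicial composition diagram -/

lemma spine_hom_ext_of_pos {Y : SSet.{u}} {n : ℕ} (hn : 0 < n) {f g : Sp.{u} n ⟶ Y}
    (he : ∀ i : Fin n, spineEdge i ≫ f = spineEdge i ≫ g) : f = g := by
  refine spine_hom_ext he ?_
  have h : spineVertex.{u} (Fin.last n) = SSet.stdSimplex.map (SimplexCategory.const ⦋0⦌ ⦋1⦌ 1) ≫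
      spineEdge ⟨n - 1, by lia⟩ := by
    rw [spineEdge_target]
    congr 1
    exact Fin.ext (by simp; lia)
  rw [h, Category.assoc, Category.assoc, he]

/-- Edges of a simplex are determined by their endpoints. This makes knowledge of the endpoints of
`τ_i` sufficient when mapping into `Δ[r]`. -/
lemma simplex_one_hom_ext {n : ℕ} {f g : (Δ[1] : SSet.{u}) ⟶ Δ[n]}
    (h0 : SSet.stdSimplex.map (SimplexCategory.const ⦋0⦌ ⦋1⦌ 0) ≫ f =
      SSet.stdSimplex.map (SimplexCategory.const ⦋0⦌ ⦋1⦌ 0) ≫ g)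
    (h1 : SSet.stdSimplex.map (SimplexCategory.const ⦋0⦌ ⦋1⦌ 1) ≫ f =
      SSet.stdSimplex.map (SimplexCategory.const ⦋0⦌ ⦋1⦌ 1) ≫ g) : f = g := by
  have key : ∀ (c : Fin 2) (t : (Δ[1] : SSet.{u}) ⟶ Δ[n]),
      SSet.stdSimplex.objEquiv (SSet.yonedaEquiv
        (SSet.stdSimplex.map (SimplexCategory.const ⦋0⦌ ⦋1⦌ c) ≫ t)) =
      SimplexCategory.const ⦋0⦌ ⦋1⦌ c ≫ SSet.stdSimplex.objEquiv (SSet.yonedaEquiv t) := by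
    intro c t
    rw [← SSet.yonedaEquiv_naturality]
    rfl
  apply SSet.yonedaEquiv.injective
  apply SSet.stdSimplex.objEquiv.injective
  ext c : 3
  have h : SimplexCategory.const ⦋0⦌ ⦋1⦌ c ≫ SSet.stdSimplex.objEquiv (SSet.yonedaEquiv f) =
      SimplexCategory.const ⦋0⦌ ⦋1⦌ c ≫ SSet.stdSimplex.objEquiv (SSet.yonedaEquiv g) := by
    rw [← key, ← key]
    fin_cases c
    · exact congrArg (fun t => SSet.stdSimplex.objEquiv (SSet.yonedaEquiv t)) h0
    · exact congrArg (fun t => SSet.stdSimplex.objEquiv (SSet.yonedaEquiv t)) h1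
  exact congrArg (fun t : ⦋0⦌ ⟶ ⦋n⦌ => t.toOrderHom 0) h

/-- The sum of the sizes of the first `i` blocks. -/
def blockSum {n : ℕ} (k : Fin n → ℕ) (i : Fin (n + 1)) : ℕ := ∑ j with j.castSucc < i, k j

lemma blockSum_castSucc {n : ℕ} (k : Fin n → ℕ) (i : Fin n) :
    blockSum k i.castSucc = blockStart k i := by
  rw [blockSum, blockStart]
  congr 1
  ext j
  simp

lemma blockSum_last {n : ℕ} (k : Fin n → ℕ) : blockSum k (Fin.last n) = ∑ i, k i := by
  rw [blockSum]
  congr 1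
  ext j
  simp [Fin.castSucc_lt_last]

lemma blockSum_succ {n : ℕ} (k : Fin n → ℕ) (i : Fin n) :
    blockSum k i.succ = blockStart k i + k i := by
  rw [blockSum, blockStart, Nat.add_comm (∑ j < i, k j), ← Finset.sum_insert (by simp)]
  congr 1
  ext j
  simp only [Finset.mem_filter, Finset.mem_univ, true_and, Finset.mem_insert, Finset.mem_Iio,
    Fin.lt_def, Fin.ext_iff, Fin.val_succ, Fin.val_castSucc]
  lia

lemma blockSum_mono {n : ℕ} (k : Fin n → ℕ) : Monotone (blockSum k) := fun i i' h =>
  Finset.sum_le_sum_of_subset fun j hj => by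
    simp only [Finset.mem_filter, Finset.mem_univ, true_and] at hj ⊢
    exact hj.trans_le h

lemma blockSum_le {n : ℕ} (k : Fin n → ℕ) (i : Fin (n + 1)) {r : ℕ} (hr : r = ∑ i, k i) :
    blockSum k i ≤ r := by
  rw [hr, ← blockSum_last]
  exact blockSum_mono k (Fin.le_last i)

/-- The map `[n] → [r]` sending `i` to `k_1 + ⋯ + k_i`. -/
def blockHom {n : ℕ} (k : Fin n → ℕ) {r : ℕ} (hr : r = ∑ i, k i) : ⦋n⦌ ⟶ ⦋r⦌ :=
  SimplexCategory.Hom.mk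
    { toFun := fun i => ⟨blockSum k i, Nat.lt_succ_of_le (blockSum_le k i hr)⟩
      monotone' := fun _ _ h => blockSum_mono k h }

lemma spineVertex_spineSub_ι {r : ℕ} (a k : ℕ) (h : a + k ≤ r) {i : Fin (k + 1)} {c : Fin (r + 1)}
    (hc : a + i.1 = c.1) :
    spineVertex.{u} i ≫ (spine k).ι ≫ SSet.stdSimplex.map (SimplexCategory.subinterval a k h) =
      SSet.stdSimplex.map (SimplexCategory.const ⦋0⦌ ⦋r⦌ c) := by
  rw [show c = ⟨a + i, by lia⟩ from Fin.ext hc.symm]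
  exact (Category.assoc _ _ _).symm.trans (congrArg (fun t => t ≫ (spine r).ι)
    (spineVertex_spineSub a k h i))

/-- A simplicial composition diagram retracts onto the simplex on its spine. -/
lemma SCD.exists_toSimplex {n : ℕ} {C : CompCospan.{u} n} (S : SCD C) :
    ∃ p : C.K ⟶ Δ[n], C.ι ≫ p = (spine n).ι := by
  induction S with
  | simplex e hι hτ =>
    refine ⟨e.inv, ?_⟩
    exact (by rw [← hι, Category.assoc, e.hom_inv_id, Category.comp_id] :
      CompCospan.ι _ ≫ e.inv = (CompCospan.simplex _).ι)
  | @graft d hd k D S r C G ih =>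
    choose p hp using ih
    -- The retraction of `K_i`, followed by the inclusion of the `i`-th interval of `[r]`.
    obtain ⟨f, f_eq⟩ : ∃ f : ∀ i, (D i).K ⟶ Δ[r], ∀ i, f i = p i ≫ SSet.stdSimplex.map
      (SimplexCategory.subinterval _ _ (blockStart_add_le k i G.arity)) := ⟨_, fun _ => rfl⟩
    have hf' (i : Fin d) (v : Fin (k i + 1)) {c : Fin (r + 1)} (hc : blockStart k i + v.1 = c.1) :
        (spineVertex v ≫ (D i).ι) ≫ f i =
          SSet.stdSimplex.map (SimplexCategory.const ⦋0⦌ ⦋r⦌ c) := by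
      rw [← spineVertex_spineSub_ι _ _ (blockStart_add_le k i G.arity) hc, ← hp, f_eq, Category.assoc,
        Category.assoc]
    have hf : IsGlued D f := by
      intro i j hij
      have h1 := blockStart_add_le k i G.arity
      rw [← Category.assoc, ← Category.assoc, hf' i (Fin.last _) (c := ⟨blockStart k i + k i, by lia⟩)
        rfl, hf' j 0]
      exact blockStart_succ k i j hij
    -- Each `τ_i` lands on the edge between the two ends of its block, so on `Δ[d]` the map has to
    -- be `blockHom`.
    have hw : G.τW ≫ G.wedgeDesc f hf =
        (CompCospan.simplex d).ι ≫ SSet.stdSimplex.map (blockHom k G.arity) := by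
      refine spine_hom_ext_of_pos (by lia) fun i => ?_
      rw [← Category.assoc, G.edge_τW, Category.assoc, G.inc_wedgeDesc]
      refine simplex_one_hom_ext ?_ ?_
      · rw [← Category.assoc, (S i).endpointsAgree.1,
          hf' i 0 (c := (blockHom k G.arity).toOrderHom i.castSucc) (blockSum_castSucc k i).symm,
          ← Category.assoc, spineEdge_source]
        exact SSet.stdSimplex.map_comp (SimplexCategory.const ⦋0⦌ ⦋d⦌ i.castSucc)
          (blockHom k G.arity)
      · rw [← Category.assoc, (S i).endpointsAgree.2,
          hf' i (Fin.last _) (c := (blockHom k G.arity).toOrderHom i.succ) (blockSum_succ k i).symm,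
          ← Category.assoc, spineEdge_target]
        exact SSet.stdSimplex.map_comp (SimplexCategory.const ⦋0⦌ ⦋d⦌ i.succ)
          (blockHom k G.arity)
    refine ⟨G.isPushout.desc _ _ hw, ?_⟩
    rw [G.ι_eq, Category.assoc]
    refine (congrArg (fun t => G.ιW ≫ t) (G.isPushout.inl_desc _ _ hw)).trans ?_
    refine G.spine_hom_ext (by lia) fun i => ?_
    rw [← Category.assoc, G.sub_ιW, Category.assoc, G.inc_wedgeDesc, f_eq, ← Category.assoc, hp]
    rfl

/-- This supplies the hypothesis `Mono C₀.ι` under which cells of the pieces are compared with cells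
of the grafting. -/
lemma SCD.mono_ι {n : ℕ} {C : CompCospan.{u} n} (S : SCD C) : Mono C.ι := by
  obtain ⟨p, hp⟩ := S.exists_toSimplex
  have : Mono (C.ι ≫ p) := by
    rw [hp]
    infer_instance
  exact mono_of_mono C.ι p

lemma IsCell.app_iso {K L : SSet.{u}} {d : ℕ} {σ : K.obj (op ⦋d⦌)} (h : IsCell K σ) (e : K ≅ L) :
    IsCell L (e.hom.app _ σ) := by
  refine IsCell.of_injective (app_injective e.inv) ?_
  have h1 : (e.hom ≫ e.inv).app _ σ = (𝟙 K :).app _ σ := by rw [e.hom_inv_id]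
  exact (h1 : e.inv.app _ (e.hom.app _ σ) = σ) ▸ h

/-! ### The elementwise description of the induced composition -/

section Extend

variable {X : BisimplicialSpace.{u}} (μ : HorizontalCompositions X) {j m : SimplexCategoryᵒᵖ}

/-- The value of `μ_d` on an element of `X_{Sp(d)}`. -/
def HorizontalCompositions.fill {d : ℕ} (φ : Sp d ⟶ column X j m) :
    (column X j m).obj (op ⦋d⦌) :=
  ((μ.μ d).app j).app m φ

lemma HorizontalCompositions.ι_fill {d : ℕ} (φ : Sp d ⟶ column X j m) :
    (spine d).ι ≫ SSet.yonedaEquiv.symm (μ.fill φ) = φ :=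
  ConcreteCategory.congr_hom (NatTrans.congr_app (NatTrans.congr_app (μ.section_ d) j) m) φ

/-- The value of `μ_K` on an element of `X_{Sp(n)}`. -/
noncomputable def SCD.extend {n : ℕ} {C : CompCospan.{u} n} (S : SCD C)
    (φ : Sp n ⟶ column X j m) : C.K ⟶ column X j m :=
  toColumn X (((S.inducedComp μ).1.app j).app m φ)

lemma SCD.ι_extend {n : ℕ} {C : CompCospan.{u} n} (S : SCD C) (φ : Sp n ⟶ column X j m) :
    C.ι ≫ S.extend μ φ = φ :=
  ConcreteCategory.congr_hom
    (NatTrans.congr_app (NatTrans.congr_app (S.inducedComp μ).2 j) m) φ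

lemma SCD.extend_simplex {n : ℕ} {C : CompCospan.{u} n} (e : (CompCospan.simplex n).K ≅ C.K)
    (hι : (CompCospan.simplex n).ι ≫ e.hom = C.ι) (hτ : (CompCospan.simplex n).τ ≫ e.hom = C.τ)
    (φ : Sp n ⟶ column X j m) :
    (SCD.simplex e hι hτ).extend μ φ = e.inv ≫ SSet.yonedaEquiv.symm (μ.fill φ) := by
  rw [SCD.extend, SCD.inducedComp]
  rfl

section Graft

/-- The compatibility condition inside `graftSection`, named so that `pushoutLift_inl` and
`pushoutLift_inr` can refer to it. -/
lemma graftSection_w {d : ℕ} {k : Fin d → ℕ} {D : ∀ i, CompCospan.{u} (k i)}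
    (s : ∀ i, SpineSection X (D i)) {r : ℕ} {C : CompCospan.{u} r}
    (G : Grafting D (CompCospan.simplex d) C) :
    G.wedgeSection s ≫ restrict X G.τW =
      (G.wedgeSection s ≫ restrict X G.τW ≫ μ.μ d ≫ (mapSpaceSimplexIso X d).inv) ≫
        restrict X (CompCospan.simplex d).ι := by
  have h : μ.μ d ≫ (mapSpaceSimplexIso X d).inv ≫ restrict X (CompCospan.simplex d).ι = 𝟙 _ :=
    μ.section_ d
  rw [Category.assoc, Category.assoc, Category.assoc, h, Category.comp_id]

variable {d : ℕ} (hd : 1 < d) {k : Fin d → ℕ} {D : ∀ i, CompCospan.{u} (k i)}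
  (S : ∀ i, SCD (D i)) {r : ℕ} {C : CompCospan.{u} r} (G : Grafting D (CompCospan.simplex d) C)
  (φ : Sp r ⟶ column X j m)

lemma SCD.inl_extend_graft (i : Fin d) :
    G.inc i ≫ G.inl ≫ (SCD.graft hd S G).extend μ φ =
      (S i).extend μ (spineSub _ _ (blockStart_add_le k i G.arity) ≫ φ) := by
  have h : ((SCD.graft hd S G).inducedComp μ).1 ≫ restrict X (G.inc i ≫ G.inl) =
      restrict X (spineSub _ _ (blockStart_add_le k i G.arity)) ≫ ((S i).inducedComp μ).1 := by
    rw [SCD.inducedComp, restrict_comp, ← Category.assoc]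
    exact (congrArg (fun t => t ≫ restrict X (G.inc i))
      (pushoutLift_inl G.isPushout (G.wedgeSection fun i => (S i).inducedComp μ) _
        (graftSection_w μ _ G))).trans
        (G.wedgeLift_inc _ _ i)
  exact ConcreteCategory.congr_hom (NatTrans.congr_app (NatTrans.congr_app h j) m) φ

/-- On `Δ[d]` the extension is the filler of the spine that the extension itself traces on the
wedge. This self-referential form is what compatibility on `Δ[d]` asks for. -/
lemma SCD.inr_extend_graft :
    G.inr ≫ (SCD.graft hd S G).extend μ φ =
      SSet.yonedaEquiv.symm (μ.fill (G.τW ≫ G.inl ≫ (SCD.graft hd S G).extend μ φ)) := by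
  have h : ((SCD.graft hd S G).inducedComp μ).1 ≫ restrict X G.inr =
      ((SCD.graft hd S G).inducedComp μ).1 ≫ restrict X (G.τW ≫ G.inl) ≫ μ.μ d ≫
        (mapSpaceSimplexIso X d).inv := by
    have h1 : ((SCD.graft hd S G).inducedComp μ).1 ≫ restrict X G.inl =
        G.wedgeSection fun i => (S i).inducedComp μ := by
      rw [SCD.inducedComp]
      exact pushoutLift_inl G.isPushout _ _ (graftSection_w μ _ G)
    have h2 : ((SCD.graft hd S G).inducedComp μ).1 ≫ restrict X G.inr =
        (G.wedgeSection fun i => (S i).inducedComp μ) ≫ restrict X G.τW ≫ μ.μ d ≫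
          (mapSpaceSimplexIso X d).inv := by
      rw [SCD.inducedComp]
      exact pushoutLift_inr G.isPushout _ _ (graftSection_w μ _ G)
    rw [h2, ← h1]
    simp only [restrict_comp, Category.assoc]
    rfl
  unfold SCD.extend
  generalize ((SCD.graft hd S G).inducedComp μ).1 = s at h ⊢
  exact ConcreteCategory.congr_hom (NatTrans.congr_app (NatTrans.congr_app h j) m) φ

end Graft

/-! ### Compatible maps -/

/-- Maps `K ⟶ X_{•,j,m}` whose values on the maximal nondegenerate simplices of `K` are given by the
horizontal compositions. -/
def IsCompatible {K : SSet.{u}} (ψ : K ⟶ column X j m) : Prop :=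
  ∀ d : ℕ, 2 ≤ d → ∀ σ : K.obj (op ⦋d⦌), IsCell K σ →
    ψ.app _ σ = μ.fill ((spine d).ι ≫ SSet.yonedaEquiv.symm σ ≫ ψ)

variable {μ}

lemma IsCompatible.comp {K L : SSet.{u}} {ψ : L ⟶ column X j m} (h : IsCompatible μ ψ) (f : K ⟶ L)
    (hf : ∀ d : ℕ, 2 ≤ d → ∀ σ : K.obj (op ⦋d⦌), IsCell K σ → IsCell L (f.app _ σ)) :
    IsCompatible μ (f ≫ ψ) := by
  intro d hd σ hσ
  refine (h d hd _ (hf d hd σ hσ)).trans ?_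
  rw [← SSet.yonedaEquiv_symm_comp, Category.assoc]

section Grafting

variable {n : ℕ} {k : Fin n → ℕ} {D : ∀ i, CompCospan.{u} (k i)} {C₀ : CompCospan.{u} n}
  {r : ℕ} {C : CompCospan.{u} r} {ψ : C.K ⟶ column X j m}

lemma IsCompatible.inc (h : IsCompatible μ ψ) (G : Grafting D C₀ C) [Mono C₀.ι] (i : Fin n) :
    IsCompatible μ (G.inc i ≫ G.inl ≫ ψ) := by
  rw [← Category.assoc]
  exact h.comp _ fun d hd σ hσ => isCell_inl G.isPushout hd (G.isCell_inc i hd hσ)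

lemma IsCompatible.inr (h : IsCompatible μ ψ) (G : Grafting D C₀ C) [Mono C₀.ι] :
    IsCompatible μ (G.inr ≫ ψ) :=
  h.comp _ fun _ hd _ hσ => isCell_inr G.isPushout hd hσ

/-- Compatibility is tested on cells of dimension at least `2`, and all of these come from the
pieces. -/
lemma IsCompatible.of_grafting (G : Grafting D C₀ C) [Mono C₀.ι]
    (h : ∀ i, IsCompatible μ (G.inc i ≫ G.inl ≫ ψ)) (h₀ : IsCompatible μ (G.inr ≫ ψ)) :
    IsCompatible μ ψ := by
  intro d hd σ hσ
  obtain ⟨i, v, rfl, hv⟩ | ⟨v, rfl, hv⟩ := G.exists_of_isCell hd hσ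
  · refine (h i d hd v hv).trans ?_
    rw [← SSet.yonedaEquiv_symm_comp, ← SSet.yonedaEquiv_symm_comp, Category.assoc, Category.assoc]
  · refine (h₀ d hd v hv).trans ?_
    rw [← SSet.yonedaEquiv_symm_comp, Category.assoc]

end Grafting

/-- The top simplex is the only cell of `Δ[d]`. -/
lemma isCompatible_simplex_iff {d : ℕ} (hd : 2 ≤ d) {ψ : (CompCospan.simplex d).K ⟶ column X j m} :
    IsCompatible μ ψ ↔
      ψ = SSet.yonedaEquiv.symm (μ.fill ((CompCospan.simplex d).ι ≫ ψ)) := by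
  have h1 : SSet.yonedaEquiv.symm (topSimplex.{u} d) = 𝟙 _ :=
    SSet.yonedaEquiv_symm_stdSimplex_id _
  have h3 : (spine d).ι ≫ SSet.yonedaEquiv.symm (topSimplex d) ≫ ψ =
      (CompCospan.simplex d).ι ≫ ψ := by
    rw [h1]
    exact congrArg (fun t => (spine d).ι ≫ t) (Category.id_comp ψ)
  refine Iff.trans ?_ (Equiv.eq_symm_apply SSet.yonedaEquiv).symm
  constructor
  · intro h
    exact (h d hd _ (isCell_topSimplex d)).trans (congrArg _ h3)
  · intro h e he σ hσ
    obtain ⟨rfl, rfl⟩ := hσ.eq_topSimplex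
    exact h.trans (congrArg _ h3).symm

lemma spine_eq_top {n : ℕ} (hn : n ≤ 1) : spine.{u} n = ⊤ := by
  ext m s
  refine iff_of_true (fun i j => ?_) trivial
  exact (Nat.le_of_lt_succ (SSet.stdSimplex.asOrderHom s j).2).trans (hn.trans (Nat.le_add_left _ _))

lemma spine_isIso {n : ℕ} (hn : n ≤ 1) : IsIso (spine.{u} n).ι := by
  rw [spine_eq_top hn]
  infer_instance

/-- The existence half of the characterisation of `μ_K`: each step of a construction introduces
values only through the maps `μ_d`. -/
lemma SCD.isCompatible_extend {n : ℕ} {C : CompCospan.{u} n} (S : SCD C)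
    (φ : Sp n ⟶ column X j m) : IsCompatible μ (S.extend μ φ) := by
  induction S with
  | @simplex n C e hι hτ =>
    have h1 : IsCompatible μ (SSet.yonedaEquiv.symm (μ.fill φ)) := by
      by_cases hn : 2 ≤ n
      · exact (isCompatible_simplex_iff hn).2 (congrArg (fun t => SSet.yonedaEquiv.symm (μ.fill t))
          (μ.ι_fill φ).symm)
      -- For `n ≤ 1` there are no cells of dimension at least `2`, so the condition is vacuous.
      · intro d hd σ hσ
        obtain ⟨rfl, -⟩ := hσ.eq_topSimplex
        exact absurd hd hn
    rw [SCD.extend_simplex]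
    refine h1.comp _ fun d hd σ hσ => hσ.app_iso e.symm
  | @graft d hd k D S r C G ih =>
    have : Mono (CompCospan.simplex.{u} d).ι := inferInstanceAs (Mono (spine d).ι)
    refine .of_grafting G (fun i => ?_) ?_
    · rw [SCD.inl_extend_graft]
      exact ih i _
    · refine (isCompatible_simplex_iff hd).2 ((SCD.inr_extend_graft μ hd S G φ).trans ?_)
      rw [← Category.assoc, G.isPushout.w, Category.assoc]

/-- Compatible maps out of a simplicial composition diagram are determined by their restrictions to
the spine. -/
lemma SCD.hom_ext_of_isCompatible {n : ℕ} {C : CompCospan.{u} n} (S : SCD C)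
    {ψ ψ' : C.K ⟶ column X j m} (h : IsCompatible μ ψ) (h' : IsCompatible μ ψ')
    (w : C.ι ≫ ψ = C.ι ≫ ψ') : ψ = ψ' := by
  induction S with
  | @simplex n C e hι hτ =>
    rw [← hι, Category.assoc, Category.assoc] at w
    rw [← cancel_epi e.hom]
    by_cases hn : 2 ≤ n
    · have key {χ : C.K ⟶ column X j m} (hχ : IsCompatible μ χ) := (isCompatible_simplex_iff hn).1
        (hχ.comp e.hom fun d hd σ hσ => hσ.app_iso e)
      rw [key h, key h', w]
    -- For `n ≤ 1` the spine is the whole simplex, so no filler is involved.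
    · have : IsIso (CompCospan.simplex.{u} n).ι := spine_isIso (by lia)
      exact (cancel_epi (CompCospan.simplex n).ι).1 w
  | @graft d hd k D S r C G ih =>
    have : Mono (CompCospan.simplex.{u} d).ι := inferInstanceAs (Mono (spine d).ι)
    have h1 : G.inl ≫ ψ = G.inl ≫ ψ' := by
      refine G.wedge_hom_ext fun i => ih i (h.inc G i) (h'.inc G i) ?_
      simp only [← Category.assoc]
      rw [← G.sub_ιW, Category.assoc _ _ G.inl, ← G.ι_eq, Category.assoc, Category.assoc, w]
    refine G.isPushout.hom_ext h1 ?_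
    -- On `Δ[d]` both maps are fillers of their spines, and the spine lies in the wedge, where they
    -- already agree.
    rw [(isCompatible_simplex_iff hd).1 (h.inr G), (isCompatible_simplex_iff hd).1 (h'.inr G)]
    rw [← Category.assoc, ← Category.assoc, ← G.isPushout.w, Category.assoc, Category.assoc, h1]

section Grafting

variable {n : ℕ} {k : Fin n → ℕ} {D : ∀ i, CompCospan.{u} (k i)} {C₀ : CompCospan.{u} n}
  {r : ℕ} {C : CompCospan.{u} r} (G : Grafting D C₀ C) (T : SCD C)
  (φ : Sp r ⟶ column X j m)

/-- The construction `T` need not be related to `G`, so the recursion defining `μ_K` is of no use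
here. Instead both sides are compatible maps on `K_i` with the same restriction to its spine. -/
lemma Grafting.inc_extend (S₀ : SCD C₀) (S : ∀ i, SCD (D i)) (i : Fin n) : G.inc i ≫ G.inl ≫ T.extend μ φ =
    (S i).extend μ (spineSub _ _ (blockStart_add_le k i G.arity) ≫ φ) := by
  have := S₀.mono_ι
  refine (S i).hom_ext_of_isCompatible ((T.isCompatible_extend φ).inc G i)
    ((S i).isCompatible_extend _) ?_
  rw [SCD.ι_extend]
  nth_rw 2 [← T.ι_extend μ φ]
  rw [G.ι_eq, ← Category.assoc, ← G.sub_ιW]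
  simp only [Category.assoc]

lemma Grafting.inr_extend (S₀ : SCD C₀) : G.inr ≫ T.extend μ φ =
    S₀.extend μ (G.τW ≫ G.inl ≫ T.extend μ φ) := by
  have := S₀.mono_ι
  refine S₀.hom_ext_of_isCompatible ((T.isCompatible_extend φ).inr G)
    (S₀.isCompatible_extend _) ?_
  rw [SCD.ι_extend, ← Category.assoc, ← G.isPushout.w, Category.assoc]

end Grafting

end Extend

/-! ### The composition operations of a grafting -/

section

variable {X : BisimplicialSpace.{u}}

lemma homSpaceCongr_snd {a a' b b' : Ob X} (ha : a = a') (hb : b = b') :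
    homSpaceCongr ha hb ≫ pullback.snd _ _ = pullback.snd _ _ := by
  subst ha hb
  exact Category.id_comp _

/-- The other projection goes to a terminal object. Thus operations may be compared in `X_1`, where
`homSpaceCongr` becomes invisible. -/
lemma homSpace_hom_ext {Z : SimplicialSpace.{u}} {a b : Ob X} {f g : Z ⟶ homSpace X a b}
    (h : f ≫ pullback.snd _ _ = g ≫ pullback.snd _ _) : f = g :=
  pullback.hom_ext (Subsingleton.elim _ _) h

lemma homProductToSpine_evalEdge {n : ℕ} (x : Fin (n + 1) → Ob X) (i : Fin n) :
    homProductToSpine X x ≫ evalEdge X (spineEdge i) = homProductEdge X x i := by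
  ext j m p
  exact spineEdge_spineDesc (homProductPath X x j m p) i

lemma evalEdge_comp {K L : SSet.{u}} (e : Δ[1] ⟶ K) (f : K ⟶ L) :
    restrict X f ≫ evalEdge X e = evalEdge X (e ≫ f) := rfl

lemma evalVertex_comp {K L : SSet.{u}} (v : Δ[0] ⟶ K) (f : K ⟶ L) :
    restrict X f ≫ evalVertex X v = evalVertex X (v ≫ f) := rfl

lemma mapSpace_spine_hom_ext {n : ℕ} {Z : SimplicialSpace.{u}} {f g : Z ⟶ mapSpace X (Sp n)}
    (he : ∀ i : Fin n, f ≫ evalEdge X (spineEdge i) = g ≫ evalEdge X (spineEdge i))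
    (hv : f ≫ evalVertex X (spineVertex (Fin.last n)) =
      g ≫ evalVertex X (spineVertex (Fin.last n))) : f = g := by
  refine mapSpace_hom_ext fun j m z => spine_hom_ext (fun i => ?_) ?_
  · apply SSet.yonedaEquiv.injective
    exact ConcreteCategory.congr_hom (NatTrans.congr_app (NatTrans.congr_app (he i) j) m) z
  · apply SSet.yonedaEquiv.injective
    exact ConcreteCategory.congr_hom (NatTrans.congr_app (NatTrans.congr_app hv j) m) z

lemma mapSpace_spine_hom_ext_of_pos {n : ℕ} (hn : 0 < n) {Z : SimplicialSpace.{u}}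
    {f g : Z ⟶ mapSpace X (Sp n)}
    (he : ∀ i : Fin n, f ≫ evalEdge X (spineEdge i) = g ≫ evalEdge X (spineEdge i)) : f = g := by
  refine mapSpace_hom_ext fun j m z => spine_hom_ext_of_pos hn fun i => ?_
  apply SSet.yonedaEquiv.injective
  exact ConcreteCategory.congr_hom (NatTrans.congr_app (NatTrans.congr_app (he i) j) m) z

lemma fibreMap_snd {A B : SimplicialSpace.{u}} {s t : A ⟶ X.obj (op ⦋0⦌)}
    {s' t' : B ⟶ X.obj (op ⦋0⦌)} (f : A ⟶ B) (hs : f ≫ s' = s) (ht : f ≫ t' = t) (a b : Ob X) :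
    fibreMap f hs ht a b ≫ pullback.snd _ _ = pullback.snd _ _ ≫ f :=
  pullback.lift_snd _ _ _

lemma fibreMap_snd_assoc {A B Z : SimplicialSpace.{u}} {s t : A ⟶ X.obj (op ⦋0⦌)}
    {s' t' : B ⟶ X.obj (op ⦋0⦌)} (f : A ⟶ B) (hs : f ≫ s' = s) (ht : f ≫ t' = t) (a b : Ob X)
    (g : B ⟶ Z) : fibreMap f hs ht a b ≫ pullback.snd _ _ ≫ g = pullback.snd _ _ ≫ f ≫ g :=
  pullback.lift_snd_assoc _ _ _ _

lemma SCD.comp_snd (μ : HorizontalCompositions X) {n : ℕ} {C : CompCospan.{u} n} (S : SCD C)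
    (x : Fin (n + 1) → Ob X) :
    S.comp μ x ≫ pullback.snd _ _ =
      homProductToSpine X x ≫ (S.inducedComp μ).1 ≫ evalEdge X C.τ := by
  rw [SCD.comp, Category.assoc, Category.assoc, fibreMap_snd]
  exact (congrArg (fun t => homProductInclusion X x ≫ t) (fibreMap_snd_assoc _ _ _ _ _ _)).trans
    (pullback.lift_snd_assoc _ _ _ _)

lemma regroup_homProductToSpine {n : ℕ} {k : Fin n → ℕ} {r : ℕ} {hr : r = ∑ i, k i}
    {y : ∀ i, Fin (k i + 1) → Ob X} {x : Fin (r + 1) → Ob X} (hx : IsFlattening hr y x)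
    (i : Fin n) :
    regroup hx ≫ Pi.π _ i ≫ homProductToSpine X (y i) =
      homProductToSpine X x ≫ restrict X (spineSub _ _ (blockStart_add_le k i hr)) := by
  -- A block may have length `0`, so the last vertex has to be checked besides the edges.
  refine mapSpace_spine_hom_ext (fun l => ?_) ?_
  · simp only [Category.assoc, homProductToSpine_evalEdge, evalEdge_comp]
    rw [spineEdge_spineSub, homProductToSpine_evalEdge, homProductEdge, homProductEdge, regroup,
      Pi.lift_π_assoc, Pi.lift_π_assoc, Category.assoc, homSpaceCongr_snd]
  · simp only [Category.assoc, homProductToSpine_evalVertex, evalVertex_comp]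
    rw [spineVertex_spineSub, homProductToSpine_evalVertex]
    simp only [← Category.assoc]
    congr 1
    · exact Subsingleton.elim _ _
    · exact congrArg _ (hx i (Fin.last _)).symm

variable (μ : HorizontalCompositions X) {n : ℕ} {k : Fin n → ℕ}
  {D : ∀ i, CompCospan.{u} (k i)} {C₀ : CompCospan.{u} n} {r : ℕ} {C : CompCospan.{u} r}
  (G : Grafting D C₀ C) (S : ∀ i, SCD (D i)) (T : SCD C)

lemma Grafting.inducedComp_inc (S₀ : SCD C₀) (i : Fin n) :
    (T.inducedComp μ).1 ≫ restrict X (G.inc i ≫ G.inl) =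
      restrict X (spineSub _ _ (blockStart_add_le k i G.arity)) ≫ ((S i).inducedComp μ).1 :=
  mapSpace_hom_ext fun _ _ z => G.inc_extend T z S₀ S i

lemma Grafting.inducedComp_inr (S₀ : SCD C₀) :
    (T.inducedComp μ).1 ≫ restrict X G.inr =
      (T.inducedComp μ).1 ≫ restrict X (G.τW ≫ G.inl) ≫ (S₀.inducedComp μ).1 :=
  mapSpace_hom_ext fun _ _ z => G.inr_extend T z S₀

/-- After projection to `X_1` both sides apply `μ_{K_0}` and then restriction along `τ_0` to a map
into `X_{Sp(n)}`, so it remains to compare these two maps. -/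
theorem Grafting.comp_eq (S₀ : SCD C₀) (hn : 1 ≤ n) {y : ∀ i, Fin (k i + 1) → Ob X} (hy : IsNestedList y)
    {x : Fin (r + 1) → Ob X} (hx : IsFlattening G.arity y x) :
    T.comp μ x ≫ homSpaceCongr (outerList_zero hn hx) (outerList_last hn hx) =
      regroup hx ≫
        Limits.Pi.map (fun i => (S i).comp μ (y i) ≫
          homSpaceCongr (outerList_castSucc hn y i).symm (outerList_succ hn hy i).symm) ≫
        S₀.comp μ (outerList hn y) := by
  -- Restricting `μ_K` along `τW` gives the string of the composites `∘_{K_i}`: its `i`-th edge is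
  -- `τ_i`, and on `K_i` the map `μ_K` is `μ_{K_i}`.
  have key : homProductToSpine X x ≫ (T.inducedComp μ).1 ≫ restrict X (G.τW ≫ G.inl) =
      regroup hx ≫ Limits.Pi.map (fun i => (S i).comp μ (y i) ≫
          homSpaceCongr (outerList_castSucc hn y i).symm (outerList_succ hn hy i).symm) ≫
        homProductToSpine X (outerList hn y) := by
    refine mapSpace_spine_hom_ext_of_pos hn fun i => ?_
    simp only [Category.assoc, homProductToSpine_evalEdge, evalEdge_comp]
    rw [homProductEdge, Pi.map_π_assoc, Category.assoc, homSpaceCongr_snd, SCD.comp_snd,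
      ← Category.assoc (Pi.π _ i), ← Category.assoc (regroup hx), regroup_homProductToSpine,
      Category.assoc, ← Category.assoc (restrict X _),
      ← G.inducedComp_inc μ S T S₀, ← Category.assoc (spineEdge i), G.edge_τW, Category.assoc,
      ← evalEdge_comp, Category.assoc]
  refine homSpace_hom_ext ?_
  simp only [Category.assoc]
  rw [homSpaceCongr_snd, SCD.comp_snd, SCD.comp_snd, G.τ_eq, ← evalEdge_comp,
    ← Category.assoc (T.inducedComp μ).1, G.inducedComp_inr μ T S₀]
  simp only [← Category.assoc] at key ⊢
  rw [key]

end

/-! ### Maps out of spines -/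

lemma exists_spine_of_edges {Y : SSet.{u}} {n : ℕ} (v : Fin (n + 1) → (Δ[0] ⟶ Y))
    (e : Fin n → (Δ[1] ⟶ Y))
    (h0 : ∀ i, SSet.stdSimplex.map (SimplexCategory.const ⦋0⦌ ⦋1⦌ 0) ≫ e i = v i.castSucc)
    (h1 : ∀ i, SSet.stdSimplex.map (SimplexCategory.const ⦋0⦌ ⦋1⦌ 1) ≫ e i = v i.succ) :
    ∃ g : Sp n ⟶ Y, (∀ i, spineEdge i ≫ g = e i) ∧ ∀ i, spineVertex i ≫ g = v i := by
  let p : Y.Path n :=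
    { vertex := fun i => SSet.yonedaEquiv (v i)
      arrow := fun i => SSet.yonedaEquiv (e i)
      arrow_src := fun i => by
        rw [← h0, const_zero_eq_δ]
        exact SSet.yonedaEquiv_naturality _ _
      arrow_tgt := fun i => by
        rw [← h1, const_one_eq_δ]
        exact SSet.yonedaEquiv_naturality _ _ }
  exact ⟨spineDesc p, fun i => SSet.yonedaEquiv.injective (spineEdge_spineDesc p i),
    fun i => SSet.yonedaEquiv.injective (spineVertex_spineDesc p i)⟩

/-! ### Decomposition of a spine into consecutive blocks -/

section Blocks

variable {n : ℕ} {k : Fin n → ℕ} {r : ℕ}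

lemma blockStart_add_le_of_lt {i j : Fin n} (h : i < j) :
    blockStart k i + k i ≤ blockStart k j := by
  rw [← blockSum_succ, ← blockSum_castSucc]
  exact blockSum_mono k (Fin.succ_le_castSucc_iff.2 h)

/-- Blocks of edges are disjoint half-open intervals. For vertices this fails: a junction belongs to
all blocks meeting there. -/
lemma block_unique {i j : Fin n} {l : Fin (k i)} {l' : Fin (k j)}
    (h : blockStart k i + l.1 = blockStart k j + l'.1) : i = j := by
  by_contra hij
  obtain hij | hij := lt_or_gt_of_ne hij
  · have := blockStart_add_le_of_lt (k := k) hij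
    lia
  · have := blockStart_add_le_of_lt (k := k) hij
    lia

variable (hr : r = ∑ i, k i)

lemma exists_block_eq {r : ℕ} (hr : r = ∑ i, k i) (e : Fin r) : ∃ (i : Fin n) (l : Fin (k i)), blockStart k i + l.1 = e.1 := by
  obtain rfl | hn := Nat.eq_zero_or_pos n
  · exact absurd e.2 (by simp [hr])
  · obtain ⟨i, h1, h2⟩ := exists_block k e.1 (n - 1) (by lia) (by
      rw [blockStart_last k hn, ← hr]
      exact e.2)
    exact ⟨i, ⟨e.1 - blockStart k i, by lia⟩, by dsimp only; lia⟩

/-- The condition on the last vertex matters only when there are no blocks at all. -/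
lemma spine_hom_ext_of_blocks {Y : SSet.{u}} {f g : Sp.{u} r ⟶ Y}
    (h : ∀ i, spineSub _ _ (blockStart_add_le k i hr) ≫ f =
      spineSub _ _ (blockStart_add_le k i hr) ≫ g)
    (hv : spineVertex (Fin.last r) ≫ f = spineVertex (Fin.last r) ≫ g) : f = g := by
  refine spine_hom_ext (fun e => ?_) hv
  obtain ⟨i, l, hl⟩ := exists_block_eq hr e
  have h1 : spineEdge.{u} e = spineEdge l ≫ spineSub _ _ (blockStart_add_le k i hr) := by
    rw [spineEdge_spineSub]
    congr 1
    exact Fin.ext hl.symm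
  rw [h1, Category.assoc, Category.assoc, h]

/-- Empty blocks between `i` and `j` can make distant blocks share a vertex, hence the induction on
the distance `t`. -/
lemma vertex_eq_of_glued {Y : SSet.{u}} {f : ∀ i, Sp.{u} (k i) ⟶ Y}
    (hf : ∀ i j : Fin n, i.1 + 1 = j.1 →
      spineVertex (Fin.last (k i)) ≫ f i = spineVertex 0 ≫ f j) (t : ℕ) :
    ∀ (i j : Fin n) (_ : j.1 = i.1 + t) (l : Fin (k i + 1)) (l' : Fin (k j + 1)),
      blockStart k i + l.1 = blockStart k j + l'.1 →
        spineVertex l ≫ f i = spineVertex l' ≫ f j := by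
  induction t with
  | zero =>
    intro i j hij l l' h
    obtain rfl : j = i := Fin.ext hij
    obtain rfl : l = l' := Fin.ext (by lia)
    rfl
  | succ t ih =>
    intro i j hij l l' h
    let i' : Fin n := ⟨i.1 + 1, by lia⟩
    have h1 := blockStart_succ k i i' rfl
    have h2 : blockStart k i' ≤ blockStart k j := by
      rw [← blockSum_castSucc, ← blockSum_castSucc]
      refine blockSum_mono k ?_
      rw [Fin.le_def]
      change i.1 + 1 ≤ j.1
      lia
    -- A vertex of block `i` that also lies in a later block is the end of block `i`, so it moves to
    -- vertex `0` of the next block.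
    obtain rfl : l = Fin.last _ := Fin.ext (by
      rw [Fin.val_last]
      lia)
    rw [hf i i' rfl]
    refine ih i' j (by dsimp only [i']; lia) 0 l' ?_
    rw [← h, h1]
    rfl

/-- A map out of `Sp(r)` is given by compatible maps out of the blocks of a decomposition. -/
lemma exists_spine_of_blocks (hn : 0 < n) {Y : SSet.{u}} (f : ∀ i, Sp.{u} (k i) ⟶ Y)
    (hf : ∀ i j : Fin n, i.1 + 1 = j.1 →
      spineVertex (Fin.last (k i)) ≫ f i = spineVertex 0 ≫ f j) :
    ∃ g : Sp r ⟶ Y, ∀ i, spineSub _ _ (blockStart_add_le k i hr) ≫ g = f i := by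
  -- Blocks containing a given vertex are chosen arbitrarily below; `key` makes the choice
  -- irrelevant.
  have key (i j : Fin n) (l : Fin (k i + 1)) (l' : Fin (k j + 1))
      (h : blockStart k i + l.1 = blockStart k j + l'.1) :
      spineVertex l ≫ f i = spineVertex l' ≫ f j := by
    obtain hij | hij := le_total i.1 j.1
    · exact vertex_eq_of_glued hf (j.1 - i.1) i j (by lia) l l' h
    · exact (vertex_eq_of_glued hf (i.1 - j.1) j i (by lia) l' l h.symm).symm
  choose ei el he using exists_block_eq hr
  have hv (v : Fin (r + 1)) : ∃ (i : Fin n) (l : Fin (k i + 1)), blockStart k i + l.1 = v.1 := by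
    obtain hv | hv := Nat.lt_or_ge v.1 r
    · obtain ⟨i, l, h⟩ := exists_block_eq hr ⟨v.1, hv⟩
      exact ⟨i, l.castSucc, h⟩
    · refine ⟨⟨n - 1, by lia⟩, Fin.last _, ?_⟩
      rw [Fin.val_last, blockStart_last k hn, ← hr]
      lia
  choose vi vl hv using hv
  obtain ⟨g, hg, hg'⟩ := exists_spine_of_edges (fun v => spineVertex (vl v) ≫ f (vi v))
    (fun e => spineEdge (el e) ≫ f (ei e))
    (fun e => by
      rw [← Category.assoc, spineEdge_source]
      refine key _ _ _ _ ((he e).trans ?_)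
      rw [hv]
      rfl)
    (fun e => by
      rw [← Category.assoc, spineEdge_target]
      refine key _ _ _ _ ?_
      rw [hv, Fin.val_succ, Fin.val_succ, ← he e]
      rfl)
  have hgv (i : Fin n) (l : Fin (k i + 1)) :
      spineVertex l ≫ spineSub _ _ (blockStart_add_le k i hr) ≫ g = spineVertex l ≫ f i := by
    rw [← Category.assoc, spineVertex_spineSub, hg']
    exact key _ _ _ _ (hv _)
  refine ⟨g, fun i => spine_hom_ext (fun l => ?_) (hgv i _)⟩
  rw [← Category.assoc, spineEdge_spineSub, hg]
  -- The block chosen for this edge is opaque; it is generalised together with the dependent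
  -- position so that `block_unique` can identify it with `i`.
  generalize_proofs h
  have h1 := he ⟨blockStart k i + l, h⟩
  generalize el ⟨blockStart k i + l, h⟩ = l' at h1 ⊢
  generalize ei ⟨blockStart k i + l, h⟩ = i' at l' h1 ⊢
  obtain rfl := block_unique h1
  obtain rfl : l' = l := Fin.ext (Nat.add_left_cancel h1)
  rfl

/-- A variant of `exists_spine_of_blocks` which includes the decomposition with no blocks. -/
lemma exists_spine_of_blocks_over {Y : SSet.{u}} (c : Sp.{u} n ⟶ Y) (f : ∀ i, Sp.{u} (k i) ⟶ Y)
    (h0 : ∀ i, spineVertex 0 ≫ f i = spineVertex i.castSucc ≫ c)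
    (h1 : ∀ i, spineVertex (Fin.last _) ≫ f i = spineVertex i.succ ≫ c) :
    ∃ g : Sp r ⟶ Y, (∀ i, spineSub _ _ (blockStart_add_le k i hr) ≫ g = f i) ∧
      spineVertex (Fin.last r) ≫ g = spineVertex (Fin.last n) ≫ c := by
  obtain rfl | hn := Nat.eq_zero_or_pos n
  · obtain rfl : r = 0 := by simpa using hr
    exact ⟨c, fun i => i.elim0, rfl⟩
  · obtain ⟨g, hg⟩ := exists_spine_of_blocks hr hn f fun i j hij => by
      rw [h1, h0]
      congr 2
      exact Fin.ext hij
    refine ⟨g, hg, ?_⟩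
    have h2 : spineVertex.{u} (Fin.last r) = spineVertex (Fin.last _) ≫
        spineSub _ _ (blockStart_add_le k ⟨n - 1, by lia⟩ hr) := by
      rw [spineVertex_spineSub]
      congr 1
      exact Fin.ext (hr.trans (blockStart_last k hn).symm)
    rw [h2, Category.assoc, hg, h1]
    congr 2
    exact Fin.ext (by simp; lia)

end Blocks

/-! ### Graftings as gluings along edges -/

/-- Data exhibiting `K` as the result of gluing the edge `τ_i` of `K_i` to the `i`-th spine edge of
`K_0` for all `i`. -/
structure EdgeGrafting {n : ℕ} {k : Fin n → ℕ} (D : ∀ i, CompCospan.{u} (k i))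
    (C₀ : CompCospan.{u} n) {r : ℕ} (C : CompCospan.{u} r) where
  arity : r = ∑ i, k i
  inc : ∀ i, (D i).K ⟶ C.K
  inr : C₀.K ⟶ C.K
  edge : ∀ i, spineEdge i ≫ C₀.ι ≫ inr = (D i).τ ≫ inc i
  sub_ι : ∀ i, spineSub _ _ (blockStart_add_le k i arity) ≫ C.ι = (D i).ι ≫ inc i
  last : spineVertex (Fin.last r) ≫ C.ι = spineVertex (Fin.last n) ≫ C₀.ι ≫ inr
  τ_eq : C.τ = C₀.τ ≫ inr
  hom_ext : ∀ {Z : SSet.{u}} {f g : C.K ⟶ Z}, (∀ i, inc i ≫ f = inc i ≫ g) →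
    inr ≫ f = inr ≫ g → f = g
  exists_desc : ∀ {Z : SSet.{u}} (f : ∀ i, (D i).K ⟶ Z) (h : C₀.K ⟶ Z),
    (∀ i, spineEdge i ≫ C₀.ι ≫ h = (D i).τ ≫ f i) →
      ∃ g : C.K ⟶ Z, (∀ i, inc i ≫ g = f i) ∧ inr ≫ g = h

section

variable {n : ℕ} {k : Fin n → ℕ} {D : ∀ i, CompCospan.{u} (k i)} {C₀ : CompCospan.{u} n}
  {r : ℕ} {C : CompCospan.{u} r}

lemma spineVertex_zero_ι {Z : SSet.{u}} {c : Sp n ⟶ Z} {i : Fin n} {f : (D i).K ⟶ Z}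
    (hD : EndpointsAgree (D i)) (h : spineEdge i ≫ c = (D i).τ ≫ f) :
    spineVertex 0 ≫ (D i).ι ≫ f = spineVertex i.castSucc ≫ c := by
  rw [← Category.assoc, ← hD.1, Category.assoc, ← h, ← Category.assoc, spineEdge_source]

lemma spineVertex_last_ι {Z : SSet.{u}} {c : Sp n ⟶ Z} {i : Fin n} {f : (D i).K ⟶ Z}
    (hD : EndpointsAgree (D i)) (h : spineEdge i ≫ c = (D i).τ ≫ f) :
    spineVertex (Fin.last _) ≫ (D i).ι ≫ f = spineVertex i.succ ≫ c := by
  rw [← Category.assoc, ← hD.2, Category.assoc, ← h, ← Category.assoc, spineEdge_target]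

/-- Since `τ_i` and the spine of `K_i` have the same endpoints, gluing the edges already glues the
junction vertices. This is why `EdgeGrafting` has no vertex condition in its universal property. -/
lemma isGlued_of_edges (hD : ∀ i, EndpointsAgree (D i)) {Z : SSet.{u}} {c : Sp n ⟶ Z}
    {f : ∀ i, (D i).K ⟶ Z} (h : ∀ i, spineEdge i ≫ c = (D i).τ ≫ f i) : IsGlued D f := by
  intro i j hij
  rw [spineVertex_last_ι (hD i) (h i), spineVertex_zero_ι (hD j) (h j)]
  congr 2
  exact Fin.ext hij

/-- A grafting as a gluing along edges. -/
def Grafting.toEdgeGrafting (G : Grafting D C₀ C) (hn : 0 < n) (hD : ∀ i, EndpointsAgree (D i)) :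
    EdgeGrafting D C₀ C where
  arity := G.arity
  inc i := G.inc i ≫ G.inl
  inr := G.inr
  edge i := by rw [← G.isPushout.w, ← Category.assoc, G.edge_τW, Category.assoc]
  sub_ι i := by rw [G.ι_eq, ← Category.assoc, G.sub_ιW, Category.assoc]
  last := by
    rw [G.ι_eq, ← Category.assoc, ← G.last_vertex hn hD, Category.assoc, G.isPushout.w]
  τ_eq := G.τ_eq
  hom_ext h h' := G.isPushout.hom_ext (G.wedge_hom_ext fun i => by simpa using h i) h'
  exists_desc f h w := by
    have w' : G.τW ≫ G.wedgeDesc f (isGlued_of_edges (c := C₀.ι ≫ h) hD w) = C₀.ι ≫ h :=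
      spine_hom_ext_of_pos hn fun i => by
        rw [← Category.assoc, G.edge_τW, Category.assoc, G.inc_wedgeDesc, w]
    refine ⟨G.isPushout.desc _ _ w', fun i => ?_, G.isPushout.inr_desc _ _ _⟩
    rw [Category.assoc, G.isPushout.inl_desc, G.inc_wedgeDesc]

variable (D) in
-- The wedge is the coequalizer of two maps from copies of `Δ[0]`, one for each consecutive pair, to
-- the coproduct of the components.
lemma exists_wedge : ∃ (W : SSet.{u}) (inc : ∀ i, (D i).K ⟶ W), IsGlued D inc ∧
    ∀ (Z : SSet.{u}) (f : ∀ i, (D i).K ⟶ Z), IsGlued D f → ∃! g : W ⟶ Z, ∀ i, inc i ≫ g = f i := by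
  let J := {p : Fin n × Fin n // p.1.1 + 1 = p.2.1}
  let a : (∐ fun _ : J => (Δ[0] : SSet.{u})) ⟶ ∐ fun i => (D i).K :=
    Sigma.desc fun p => spineVertex (Fin.last _) ≫ (D p.1.1).ι ≫ Sigma.ι (fun i => (D i).K) p.1.1
  let b : (∐ fun _ : J => (Δ[0] : SSet.{u})) ⟶ ∐ fun i => (D i).K :=
    Sigma.desc fun p => spineVertex 0 ≫ (D p.1.2).ι ≫ Sigma.ι (fun i => (D i).K) p.1.2
  refine ⟨coequalizer a b, fun i => Sigma.ι (fun i => (D i).K) i ≫ coequalizer.π a b, ?_, ?_⟩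
  · intro i j hij
    have h := congrArg (fun t => Sigma.ι (fun _ : J => (Δ[0] : SSet.{u})) ⟨(i, j), hij⟩ ≫ t)
      (coequalizer.condition a b)
    simpa [a, b] using h
  · intro Z f hf
    have w : a ≫ Sigma.desc f = b ≫ Sigma.desc f := by
      refine Sigma.hom_ext _ _ fun p => ?_
      simpa [a, b] using hf _ _ p.2
    refine ⟨coequalizer.desc (Sigma.desc f) w, fun i => by simp, fun g hg => ?_⟩
    refine coequalizer.hom_ext (Sigma.hom_ext _ _ fun i => ?_)
    simpa using hg i

/-- The wedge is constructed separately, and the edge conditions are reassembled into the single map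
`τW`, which turns the universal property of `E` into a pushout along `τW`. -/
lemma EdgeGrafting.nonempty_grafting (E : EdgeGrafting D C₀ C) (hn : 0 < n)
    (hD : ∀ i, EndpointsAgree (D i)) : Nonempty (Grafting D C₀ C) := by
  obtain ⟨W, inc, hinc, hW⟩ := exists_wedge D
  obtain ⟨ιW, hι⟩ := exists_spine_of_blocks E.arity hn (fun i => (D i).ι ≫ inc i) hinc
  obtain ⟨τW, hτ⟩ : ∃ τW : Sp n ⟶ W, ∀ i, spineEdge i ≫ τW = (D i).τ ≫ inc i := by
    -- A junction of the wedge is the start of one block and the end of the previous one; gluing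
    -- makes these the same vertex. The last junction is only the end of block `n - 1`.
    have hv (i : Fin (n + 1)) : ∃ v : Δ[0] ⟶ W,
        (∀ j : Fin n, j.castSucc = i → spineVertex 0 ≫ (D j).ι ≫ inc j = v) ∧
          ∀ j : Fin n, j.succ = i → spineVertex (Fin.last _) ≫ (D j).ι ≫ inc j = v := by
      by_cases hi : i.1 < n
      · refine ⟨_, fun j hj => ?_, fun j hj => hinc j ⟨i.1, hi⟩ (congrArg Fin.val hj)⟩
        obtain rfl : j = ⟨i.1, hi⟩ := Fin.ext (congrArg Fin.val hj :)
        rfl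
      · refine ⟨spineVertex (Fin.last _) ≫ (D ⟨n - 1, by lia⟩).ι ≫ inc _,
          fun j hj => absurd (hj ▸ j.2) hi, fun j hj => ?_⟩
        · obtain rfl : j = ⟨n - 1, by lia⟩ := Fin.ext (by
            have := congrArg Fin.val hj
            simp at this ⊢
            lia)
          rfl
    choose v hv0 hv1 using hv
    obtain ⟨g, hg, -⟩ := exists_spine_of_edges v (fun i => (D i).τ ≫ inc i)
      (fun i => by rw [← Category.assoc, (hD i).1, Category.assoc, hv0 _ i rfl])
      (fun i => by rw [← Category.assoc, (hD i).2, Category.assoc, hv1 _ i rfl])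
    exact ⟨g, hg⟩
  obtain ⟨inl, hinl, -⟩ := hW C.K E.inc (isGlued_of_edges (c := C₀.ι ≫ E.inr) hD E.edge)
  have w : τW ≫ inl = C₀.ι ≫ E.inr := spine_hom_ext_of_pos hn fun i => by
    rw [← Category.assoc, hτ, Category.assoc, hinl, ← E.edge]
  refine ⟨⟨E.arity, W, inc, hinc, hW, ιW, hι, τW, hτ, inl, E.inr, ⟨⟨w⟩, ⟨?_⟩⟩, ?_, E.τ_eq⟩⟩
  · have h (s : PushoutCocone τW C₀.ι) := E.exists_desc (fun i => inc i ≫ s.inl) s.inr fun i => by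
      rw [← s.condition, ← Category.assoc, hτ, Category.assoc]
    refine PushoutCocone.IsColimit.mk w (fun s => (h s).choose) (fun s => ?_)
      (fun s => (h s).choose_spec.2) (fun s m h1 h2 => ?_)
    · refine (hW _ (fun i => inc i ≫ s.inl) ?_).unique (fun i => ?_) fun i => rfl
      · exact isGlued_of_edges hD (c := τW ≫ s.inl) fun i => by
          rw [← Category.assoc, hτ, Category.assoc]
      · rw [← Category.assoc, hinl]
        exact (h s).choose_spec.1 i
    · refine E.hom_ext (fun i => ?_) (h2.trans (h s).choose_spec.2.symm)
      rw [(h s).choose_spec.1, ← hinl, Category.assoc, h1]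
  · refine spine_hom_ext_of_blocks E.arity (fun i => ?_) ?_
    · rw [E.sub_ι, ← Category.assoc, hι, Category.assoc, hinl]
    · have h1 : spineVertex.{u} (Fin.last r) = spineVertex (Fin.last _) ≫
          spineSub _ _ (blockStart_add_le k ⟨n - 1, by lia⟩ E.arity) := by
        rw [spineVertex_spineSub]
        congr 1
        exact Fin.ext (E.arity.trans (blockStart_last k hn).symm)
      rw [h1, Category.assoc, E.sub_ι, Category.assoc, ← Category.assoc (spineSub _ _ _), hι,
        Category.assoc, hinl]

variable (D C₀) in
-- All edges are glued at once by a pushout of coproducts. Arity `0` is allowed, since inner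
-- diagrams may have it; then the spine of the result is taken from `C₀`.
lemma exists_edgeGrafting (hD : ∀ i, EndpointsAgree (D i)) (hr : r = ∑ i, k i) :
    ∃ C : CompCospan.{u} r, Nonempty (EdgeGrafting D C₀ C) := by
  let a : (∐ fun _ : Fin n => (Δ[1] : SSet.{u})) ⟶ ∐ fun i => (D i).K :=
    Sigma.desc fun i => (D i).τ ≫ Sigma.ι (fun i => (D i).K) i
  let b : (∐ fun _ : Fin n => (Δ[1] : SSet.{u})) ⟶ C₀.K := Sigma.desc fun i => spineEdge i ≫ C₀.ι
  have w (i : Fin n) : spineEdge i ≫ C₀.ι ≫ pushout.inr a b =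
      (D i).τ ≫ Sigma.ι (fun i => (D i).K) i ≫ pushout.inl a b := by
    have h := congrArg (fun t => Sigma.ι (fun _ : Fin n => (Δ[1] : SSet.{u})) i ≫ t)
      (pushout.condition (f := a) (g := b))
    simpa [a, b] using h.symm
  obtain ⟨ι, h1, h2⟩ := exists_spine_of_blocks_over hr (C₀.ι ≫ pushout.inr a b)
    (fun i => (D i).ι ≫ Sigma.ι (fun i => (D i).K) i ≫ pushout.inl a b)
    (fun i => spineVertex_zero_ι (hD i) (w i)) (fun i => spineVertex_last_ι (hD i) (w i))
  refine ⟨⟨pushout a b, ι, C₀.τ ≫ pushout.inr a b⟩, ⟨⟨hr, _, _, w, h1, h2, rfl, ?_, ?_⟩⟩⟩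
  · intro Z f g h h'
    exact pushout.hom_ext (Sigma.hom_ext _ _ fun i => by simpa using h i) h'
  · intro Z f h hw
    have w' : a ≫ Sigma.desc f = b ≫ h := by
      refine Sigma.hom_ext _ _ fun i => ?_
      simpa [a, b] using (hw i).symm
    exact ⟨pushout.desc (Sigma.desc f) h w', fun i => by
      rw [Category.assoc, pushout.inl_desc, Sigma.ι_desc], pushout.inr_desc _ _ _⟩

end

/-! ### Associativity of grafting -/

section

variable {n : ℕ} {k : Fin n → ℕ} {D : ∀ i, CompCospan.{u} (k i)} {C₀ : CompCospan.{u} n}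
  {r : ℕ} {C : CompCospan.{u} r}

/-- The spine vertices of `K_0` are the junctions between blocks on the spine of the result. -/
lemma EdgeGrafting.vertex (E : EdgeGrafting D C₀ C) (hD : ∀ i, EndpointsAgree (D i))
    (i : Fin (n + 1)) {v : Fin (r + 1)} (hv : v.1 = blockSum k i) :
    spineVertex v ≫ C.ι = spineVertex i ≫ C₀.ι ≫ E.inr := by
  induction i using Fin.lastCases with
  | last =>
    obtain rfl : v = Fin.last r := Fin.ext (by rw [hv, blockSum_last, ← E.arity]; rfl)
    exact E.last
  | cast i =>
    rw [← spineVertex_zero_ι (hD i) (E.edge i), ← E.sub_ι, ← Category.assoc, spineVertex_spineSub]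
    congr 2
    exact Fin.ext (hv.trans (blockSum_castSucc k i))

lemma spineSub_comp {r a k a' k' a'' : ℕ} (h : a + k ≤ k') (h' : a' + k' ≤ r)
    (h'' : a'' + k ≤ r) (ha : a' + a = a'') :
    spineSub.{u} a k h ≫ spineSub a' k' h' = spineSub a'' k h'' := by
  subst ha
  refine spine_hom_ext (fun i => ?_) ?_
  · rw [← Category.assoc, spineEdge_spineSub, spineEdge_spineSub, spineEdge_spineSub]
    congr 1
    exact Fin.ext (Nat.add_assoc _ _ _).symm
  · rw [← Category.assoc, spineVertex_spineSub, spineVertex_spineSub, spineVertex_spineSub]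
    congr 1
    exact Fin.ext (Nat.add_assoc _ _ _).symm

end

/-! ### Arithmetic of nested block decompositions -/

section

variable {d : ℕ} {e : Fin d → ℕ} {n : ℕ} (hn : n = ∑ a, e a)

/-- The `b`-th element of the `a`-th block. -/
def blockIndex (a : Fin d) (b : Fin (e a)) : Fin n :=
  ⟨blockStart e a + b, by
    have := blockStart_add_le e a hn
    lia⟩

lemma blockIndex_bijective :
    Function.Bijective fun p : (a : Fin d) × Fin (e a) => blockIndex hn p.1 p.2 := by
  constructor
  · rintro ⟨a, b⟩ ⟨a', b'⟩ h
    have h1 : blockStart e a + b.1 = blockStart e a' + b'.1 := congrArg Fin.val h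
    obtain rfl := block_unique h1
    obtain rfl : b = b' := Fin.ext (Nat.add_left_cancel h1)
    rfl
  · intro i
    obtain ⟨a, b, h⟩ := exists_block_eq hn i
    exact ⟨⟨a, b⟩, Fin.ext h⟩

lemma exists_of_blockIndex {P : Fin n → Type*} (g : ∀ a b, P (blockIndex hn a b)) :
    ∃ f : ∀ i, P i, ∀ a b, f (blockIndex hn a b) = g a b :=
  ⟨Equiv.piCongrLeft P (Equiv.ofBijective _ (blockIndex_bijective hn)) fun p => g p.1 p.2,
    fun a b => Equiv.piCongrLeft_apply_apply P (Equiv.ofBijective _ (blockIndex_bijective hn)) _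
      ⟨a, b⟩⟩

/-- The inner half of a double induction: `h` is the outer induction hypothesis at the start of
block `a`, and the induction here runs inside that block. -/
lemma blockSum_add_of_blockSum {k : Fin n → ℕ} {k' : Fin d → ℕ} {a : Fin d}
    (h : ∀ {i : Fin (n + 1)}, i.1 = blockSum e a.castSucc → blockSum k i = blockSum k' a.castSucc)
    (b : Fin (e a + 1)) {i : Fin (n + 1)} (hi : i.1 = blockStart e a + b.1) :
    blockSum k i = blockStart k' a + blockSum (fun b => k (blockIndex hn a b)) b := by
  induction b using Fin.induction generalizing i with
  | zero =>
    rw [h (hi.trans (blockSum_castSucc e a).symm), blockSum_castSucc]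
    simp [blockSum]
  | succ b ih =>
    obtain rfl : i = (blockIndex hn a b).succ := Fin.ext hi
    rw [blockSum_succ, blockSum_succ, ← blockSum_castSucc, ih (by rfl), blockSum_castSucc]
    exact Nat.add_assoc _ _ _

lemma blockSum_blockSum {k : Fin n → ℕ} {k' : Fin d → ℕ}
    (hk : ∀ a, k' a = ∑ b, k (blockIndex hn a b)) (a : Fin (d + 1)) {i : Fin (n + 1)}
    (hi : i.1 = blockSum e a) : blockSum k i = blockSum k' a := by
  induction a using Fin.induction generalizing i with
  | zero =>
    obtain rfl : i = 0 := Fin.ext (hi.trans (by simp [blockSum]))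
    simp [blockSum]
  | succ a ih =>
    rw [blockSum_add_of_blockSum hn ih (Fin.last _) (hi.trans (blockSum_succ e a)), blockSum_last,
      ← hk, blockSum_succ]

lemma blockStart_blockIndex {k : Fin n → ℕ} {k' : Fin d → ℕ}
    (hk : ∀ a, k' a = ∑ b, k (blockIndex hn a b)) (a : Fin d) (b : Fin (e a)) :
    blockStart k (blockIndex hn a b) =
      blockStart k' a + blockStart (fun b => k (blockIndex hn a b)) b := by
  rw [← blockSum_castSucc, ← blockSum_castSucc _ b]
  exact blockSum_add_of_blockSum hn (blockSum_blockSum hn hk a.castSucc) b.castSucc rfl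

lemma sum_of_blockIndex {k : Fin n → ℕ} {k' : Fin d → ℕ}
    (hk : ∀ a, k' a = ∑ b, k (blockIndex hn a b)) : ∑ i, k i = ∑ a, k' a := by
  rw [← blockSum_last, ← blockSum_last]
  exact blockSum_blockSum hn hk _ ((blockSum_last e).trans hn.symm).symm

end

section

variable {d : ℕ} {e : Fin d → ℕ} {D₀ : ∀ a, CompCospan.{u} (e a)} {B : CompCospan.{u} d}
  {n : ℕ} {C₀ : CompCospan.{u} n} {k : Fin n → ℕ} {D : ∀ i, CompCospan.{u} (k i)}
  {r : ℕ} {C : CompCospan.{u} r} {k' : Fin d → ℕ} {C' : ∀ a, CompCospan.{u} (k' a)}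

/-- Grafting the `D_i` onto the grafting of the `D₀_a` onto `B` amounts to grafting the graftings
`C'_a` of the `D_i` onto the `D₀_a` onto `B`. -/
lemma EdgeGrafting.assoc (E : EdgeGrafting D C₀ C) (E₀ : EdgeGrafting D₀ B C₀)
    (E' : ∀ a, EdgeGrafting (fun b => D (blockIndex E₀.arity a b)) (D₀ a) (C' a))
    (hD : ∀ i, EndpointsAgree (D i)) : Nonempty (EdgeGrafting C' B C) := by
  have harity : r = ∑ a, k' a :=
    E.arity.trans (sum_of_blockIndex E₀.arity fun a => (E' a).arity)
  -- The spine of `D₀ a` is the `a`-th block of the spine of `C₀`, so the edges at which `C' a` is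
  -- glued are already identified in `C`.
  have h (a : Fin d) := (E' a).exists_desc (fun b => E.inc (blockIndex E₀.arity a b))
    (E₀.inc a ≫ E.inr) fun b => by
      rw [← E.edge, ← Category.assoc (D₀ a).ι, ← E₀.sub_ι, Category.assoc, ← Category.assoc,
        spineEdge_spineSub]
      rfl
  choose inc hinc hinr using h
  refine ⟨⟨harity, inc, E₀.inr ≫ E.inr, fun a => ?_, fun a => ?_, ?_, ?_, ?_, ?_⟩⟩
  · rw [(E' a).τ_eq, Category.assoc, hinr]
    simpa only [Category.assoc] using E₀.edge a =≫ E.inr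
  · refine spine_hom_ext_of_blocks (E' a).arity (fun b => ?_) ?_
    · rw [← Category.assoc, ← Category.assoc (spineSub _ _ _) (C' a).ι, (E' a).sub_ι,
        spineSub_comp _ _ (blockStart_add_le k (blockIndex E₀.arity a b) E.arity)
          (blockStart_blockIndex E₀.arity (fun a => (E' a).arity) a b).symm, E.sub_ι,
        Category.assoc, hinc]
    -- This vertex check covers inner diagrams `D₀ a` of arity `0`, which contribute no blocks.
    · rw [← Category.assoc, spineVertex_spineSub, ← Category.assoc, (E' a).last, Category.assoc,
        Category.assoc, hinr, ← Category.assoc (D₀ a).ι, ← E₀.sub_ι, Category.assoc,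
        ← Category.assoc (spineVertex _), spineVertex_spineSub]
      refine E.vertex hD _ ?_
      rw [blockSum_blockSum E₀.arity (fun a => (E' a).arity) a.succ, blockSum_succ]
      · rfl
      · exact (blockSum_succ e a).symm
  · rw [E.last, ← Category.assoc, E₀.last]
    simp only [Category.assoc]
  · rw [E.τ_eq, E₀.τ_eq, Category.assoc]
  · intro Z f g h1 h2
    refine E.hom_ext (fun i => ?_) (E₀.hom_ext (fun a => ?_) ?_)
    · obtain ⟨⟨a, b⟩, rfl⟩ := (blockIndex_bijective E₀.arity).2 i
      dsimp only
      rw [← hinc, Category.assoc, Category.assoc, h1]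
    · rw [← Category.assoc, ← Category.assoc, ← hinr, Category.assoc, Category.assoc, h1]
    · simpa only [Category.assoc] using h2
  · intro Z f h hw
    -- A map out of `C` is built from the inside: the parts on the `D₀ a` and on `B` give `g₀` on
    -- `C₀`, and then the parts on the `D i`, reindexed as `F`, are added.
    obtain ⟨g₀, hg₀, hg₀'⟩ := E₀.exists_desc (fun a => (E' a).inr ≫ f a) h fun a => by
      rw [hw, (E' a).τ_eq, Category.assoc]
    obtain ⟨F, hF⟩ := exists_of_blockIndex E₀.arity (P := fun i => (D i).K ⟶ Z)
      fun a b => (E' a).inc b ≫ f a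
    obtain ⟨g, hg, hg'⟩ := E.exists_desc F g₀ fun i => by
      obtain ⟨⟨a, b⟩, rfl⟩ := (blockIndex_bijective E₀.arity).2 i
      dsimp only
      rw [hF, ← Category.assoc, ← Category.assoc, ← (E' a).edge]
      have h1 : spineEdge.{u} (blockIndex E₀.arity a b) =
          spineEdge b ≫ spineSub _ _ (blockStart_add_le e a E₀.arity) := by
        rw [spineEdge_spineSub]
        rfl
      rw [h1]
      have h2 := E₀.sub_ι a
      simp only [Category.assoc, ← hg₀]
      rw [← Category.assoc (spineSub _ _ _), h2, Category.assoc]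
    refine ⟨g, fun a => (E' a).hom_ext (fun b => ?_) ?_, ?_⟩
    · rw [← Category.assoc, hinc, hg, hF]
    · rw [← Category.assoc, hinr, Category.assoc, hg', hg₀]
    · rw [Category.assoc, hg', hg₀']

end

/-! ### Closure of simplicial composition diagrams under grafting -/

section

variable {n : ℕ} {k : Fin n → ℕ} {D : ∀ i, CompCospan.{u} (k i)} {C₀ : CompCospan.{u} n}
  {r : ℕ} {C : CompCospan.{u} r}

/-- Simplicial composition diagrams are invariant under isomorphisms of cospans. -/
def SCD.ofIso {n : ℕ} {C C' : CompCospan.{u} n} (S : SCD C) (i : C.K ≅ C'.K)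
    (hι : C.ι ≫ i.hom = C'.ι) (hτ : C.τ ≫ i.hom = C'.τ) : SCD C' :=
  match S with
  | .simplex e hι' hτ' => .simplex (e ≪≫ i) (by rw [← hι, ← hι', Category.assoc]; rfl)
      (by rw [← hτ, ← hτ', Category.assoc]; rfl)
  | .graft hd S G => .graft hd S
      { G with
        inl := G.inl ≫ i.hom
        inr := G.inr ≫ i.hom
        isPushout := G.isPushout.of_iso (Iso.refl _) (Iso.refl _) (Iso.refl _) i (by simp) (by simp)
          (by simp) (by simp)
        ι_eq := by rw [← hι, G.ι_eq, Category.assoc]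
        τ_eq := by rw [← hτ, G.τ_eq, Category.assoc] }

/-- The isomorphism-invariance of gluings along edges. -/
def EdgeGrafting.ofIso {C₀' : CompCospan.{u} n} (E : EdgeGrafting D C₀ C) (i : C₀'.K ≅ C₀.K)
    (hι : C₀'.ι ≫ i.hom = C₀.ι) (hτ : C₀'.τ ≫ i.hom = C₀.τ) : EdgeGrafting D C₀' C where
  arity := E.arity
  inc := E.inc
  inr := i.hom ≫ E.inr
  edge l := by rw [← E.edge, ← hι, Category.assoc]
  sub_ι := E.sub_ι
  last := by rw [E.last, ← hι, Category.assoc]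
  τ_eq := by rw [E.τ_eq, ← hτ, Category.assoc]
  hom_ext h h' := E.hom_ext h (by simpa using h')
  exists_desc f h w := by
    obtain ⟨g, h1, h2⟩ := E.exists_desc f (i.inv ≫ h) fun l => by
      rw [← w, ← hι, Category.assoc, i.hom_inv_id_assoc]
    exact ⟨g, h1, by rw [Category.assoc, h2, i.hom_inv_id_assoc]⟩

/-- Nothing is grafted, so `inr` is an isomorphism of cospans. -/
lemma EdgeGrafting.nonempty_SCD_zero {k : Fin 0 → ℕ} {D : ∀ i, CompCospan.{u} (k i)}
    {C₀ : CompCospan.{u} 0} (E : EdgeGrafting D C₀ C) (S₀ : SCD C₀) : Nonempty (SCD C) := by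
  obtain rfl : r = 0 := by simpa using E.arity
  obtain ⟨g, -, hg⟩ := E.exists_desc (fun i => i.elim0) (𝟙 _) fun i => i.elim0
  refine ⟨S₀.ofIso ⟨E.inr, g, hg, E.hom_ext (fun i => i.elim0) ?_⟩ ?_ E.τ_eq.symm⟩
  · rw [← Category.assoc, hg, Category.id_comp, Category.comp_id]
  · refine spine_hom_ext (fun i => i.elim0) ?_
    rw [E.last]

/-- Gluing an edge to `Δ[1]` along its only spine edge adds nothing, so the result is `D 0`. The
case is separate because `SCD.graft` requires more than one piece. -/
lemma EdgeGrafting.nonempty_SCD_one {k : Fin 1 → ℕ} {D : ∀ i, CompCospan.{u} (k i)}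
    (E : EdgeGrafting D (CompCospan.simplex 1) C) (S : SCD (D 0)) : Nonempty (SCD C) := by
  have hk : r = k 0 := by simpa using E.arity
  subst hk
  have h1 : spineEdge.{u} (0 : Fin 1) ≫ (CompCospan.simplex 1).ι = 𝟙 _ := by
    refine Eq.trans (congrArg SSet.stdSimplex.map ?_) (SSet.stdSimplex.map_id ⦋1⦌)
    ext c : 3
    fin_cases c <;> rfl
  have h2 : (CompCospan.simplex.{u} 1).τ = 𝟙 _ := by
    refine Eq.trans (congrArg SSet.stdSimplex.map ?_) (SSet.stdSimplex.map_id ⦋1⦌)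
    ext c : 3
    fin_cases c <;> rfl
  have h3 : E.inr = (D 0).τ ≫ E.inc 0 := by
    rw [← E.edge, ← Category.assoc, h1]
    exact (Category.id_comp _).symm
  obtain ⟨g, hg, hg'⟩ := E.exists_desc
    (Fin.cases (motive := fun i => (D i).K ⟶ (D 0).K) (𝟙 _) fun i => i.elim0) (D 0).τ fun i => by
      obtain rfl : i = 0 := Subsingleton.elim _ _
      exact (Category.assoc _ _ _).symm.trans ((congrArg (fun t => t ≫ (D 0).τ) h1).trans
        ((Category.id_comp _).trans (Category.comp_id _).symm))
  have hg₀ : E.inc 0 ≫ g = 𝟙 _ := hg 0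
  refine ⟨S.ofIso ⟨E.inc 0, g, hg₀, E.hom_ext (fun i => ?_) ?_⟩ ?_ ?_⟩
  · obtain rfl : i = 0 := Subsingleton.elim _ _
    rw [← Category.assoc, hg₀, Category.id_comp, Category.comp_id]
  · rw [← Category.assoc, hg']
    exact h3.symm.trans (Category.comp_id _).symm
  -- The only block starts at `0` and has full length, so its inclusion into the spine is the
  -- identity.
  · refine (E.sub_ι 0).symm.trans (Eq.trans ?_ (Category.id_comp _))
    congr 1
    rw [← cancel_mono (spine _).ι]
    refine Eq.trans ?_ (Category.id_comp _).symm
    refine Eq.trans (congrArg (fun t => (spine (k 0)).ι ≫ SSet.stdSimplex.map t) (?_ : _ = 𝟙 _))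
      ((congrArg (fun t => (spine (k 0)).ι ≫ t) (SSet.stdSimplex.map_id _)).trans
        (Category.comp_id _))
    ext c : 3
    exact Fin.ext (congrArg (fun t => c.1 + t) (blockStart_zero k Nat.one_pos))
  · rw [E.τ_eq, h2, ← h3]
    exact (Category.id_comp _).symm

/-- Induction on the construction of the base `C₀`, for all pieces grafted onto it. For a simplex
this is a defining step up to arities `0` and `1`; for a grafting, associativity moves the pieces
onto the smaller bases. -/
theorem EdgeGrafting.nonempty_SCD (S₀ : SCD C₀) (S : ∀ i, SCD (D i)) (E : EdgeGrafting D C₀ C) :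
    Nonempty (SCD C) := by
  induction S₀ generalizing r with
  | @simplex n C₀ e hι hτ =>
    have E' := E.ofIso e hι hτ
    obtain _ | _ | n := n
    · exact E.nonempty_SCD_zero (.simplex e hι hτ)
    · exact E'.nonempty_SCD_one (S 0)
    · obtain ⟨G⟩ := E'.nonempty_grafting (by lia) fun i => (S i).endpointsAgree
      exact ⟨.graft (by lia) S G⟩
  | @graft d hd e D₀ S₀ n C₀ G₀ ih =>
    have E₀ := G₀.toEdgeGrafting (by lia) fun a => (S₀ a).endpointsAgree
    have hD (i : Fin n) := (S i).endpointsAgree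
    -- The partial graftings onto the `D₀ a` are formed as edge gluings, because some `D₀ a` may
    -- have arity `0`; the induction hypothesis makes them simplicial composition diagrams.
    have h (a : Fin d) := exists_edgeGrafting (fun b => D (blockIndex E₀.arity a b)) (D₀ a)
      (fun b => hD _) rfl
    choose C' E' using h
    have E' (a : Fin d) := (E' a).some
    obtain ⟨E''⟩ := E.assoc E₀ E' hD
    obtain ⟨G⟩ := E''.nonempty_grafting (by lia)
      fun a => (ih a (fun b => S _) (E' a)).some.endpointsAgree
    exact ⟨.graft hd (fun a => (ih a (fun b => S _) (E' a)).some) G⟩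

end

end GraftedComp

open GraftedComp
theorem mainTheorem7 (X : BisimplicialSpace.{u}) (hX : IsTwoFoldSegalSpace X)
    (μ : HorizontalCompositions X) {n : ℕ} (hn : 1 ≤ n) {k : Fin n → ℕ}
    {D : ∀ i, CompCospan.{u} (k i)} (S : ∀ i, SCD (D i))
    {C₀ : CompCospan.{u} n} (S₀ : SCD C₀)
    {r : ℕ} {C : CompCospan.{u} r} (G : Grafting D C₀ C)
    (y : ∀ i, Fin (k i + 1) → Ob X) (hy : IsNestedList y)
    (x : Fin (r + 1) → Ob X) (hx : IsFlattening G.arity y x) :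
    Nonempty (SCD C) ∧
      ∀ T : SCD C,
        T.comp μ x ≫ homSpaceCongr (outerList_zero hn hx) (outerList_last hn hx) =
          regroup hx ≫
            Limits.Pi.map (fun i => (S i).comp μ (y i) ≫
              homSpaceCongr (outerList_castSucc hn y i).symm (outerList_succ hn hy i).symm) ≫
            S₀.comp μ (outerList hn y) :=
  ⟨(G.toEdgeGrafting hn fun i => (S i).endpointsAgree).nonempty_SCD S₀ S,
    fun T => G.comp_eq μ S T S₀ hn hy hx⟩
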